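/- **Theorem.** Let $d\ge 1$, $m\ge 0$, $A\in\mathbb R^{d\times d}$, $B\in\mathbb R^{d\times m}$. Assume that all complex eigenvalues of $A$ lie in the closed unit disk, that every eigenvalue of modulus $1$ has equal algebraic and geometric multiplicities, and that $(A,B)$ is stabilizable, i.e. there is $K\in\mathbb R^{m\times d}$ such that all eigenvalues of $A+BK$ lie in the open unit disk. Let $(w_t)_{t\ge 0}$ be mutually independent (not necessarily identically distributed) random vectors in $\mathbb R^d$ with $\mathsf E[w_t]=0$ for all $t$ and $\sup_{t\ge 0}\mathsf E\|w_t\|^4<\infty$, where $\|\cdot\|$ is the Euclidean norm. Then there exist $R>0$, an integer $k$ with $1\le k\le d$, and a deterministic $k$-history-dependent policy, i.e. a sequence of measurable maps $\pi_t:(\mathbb R^d)^k\to\mathbb R^m$, $t\ge 0$, with $\|\pi_t(\cdot)\|\le R$ for every $t$, such that the following hold for the closed-loop system $$x_{t+1}=Ax_t+B\,\pi_t(x_t,x_{t-1},\dots,x_{t-k+1})+w_t,\qquad x_0=x,\quad t\ge 0,$$ with the convention $x_{-k+1}=\dots=x_{-1}=x_0$. * (P1) For every $x\in\mathbb R^d$,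 the solution with $x_0=x$ satisfies $\sup_{t\ge 0}\mathsf E\|x_t\|^2<\infty$. * (P2) In the absence of noise ($w_t= 0$ for all $t$) the origin is globally asymptotically stable for the closed-loop system: for every $\varepsilon>0$ there is $\delta>0$ such that $\|x\|<\delta$ implies $\|x_t\|<\varepsilon$ for all $t\ge 0$, and $x_t\to 0$ as $t\to\infty$ for every $x\in\mathbb R^d$. Moreover, the unit-circle part of the state reaches zero in finite time: for every $x$ there is $T$ such that for all $t\ge T$ the component of $x_t$ in the sum of the generalized eigenspaces of $A$ for eigenvalues of modulus $1$ is zero, i.e. $x_t$ lies in the sum of the generalized eigenspaces (over $\mathbb C$) for eigenvalues of modulus less than $1$. The policy can be chosen as the successive concatenation of a single sequence of $k$ maps $f_0,\dots,f_{k-1}:\mathbb R^d\to\mathbb R^m$, applied to the first state of each time segment of length $k$: $\pi_t(x_t,\dots,x_{t-k+1})=f_{t \bmod k}\bigl(x_{t-(t\bmod k)}\bigr)$. -/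

import Mathlib

open MeasureTheory ProbabilityTheory Filter Topology
open scoped ENNReal

noncomputable section

/-- Euclidean space `ℝⁿ` with the standard 2-norm. -/
abbrev RVec (n : ℕ) : Type := EuclideanSpace ℝ (Fin n)

/-- The complexification of a real square matrix, as an endomorphism of `ℂᵈ`. -/
def complexEnd {d : ℕ} (A : Matrix (Fin d) (Fin d) ℝ) : Module.End ℂ (Fin d → ℂ) :=
  Matrix.toLin' (A.map Complex.ofReal)

/-- All complex eigenvalues of `A` lie in the open unit disk. -/
def SchurStable {d : ℕ} (A : Matrix (Fin d) (Fin d) ℝ) : Prop :=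
  ∀ z : ℂ, (complexEnd A).HasEigenvalue z → ‖z‖ < 1

/-- All complex eigenvalues of `A` lie in the closed unit disk, and those of modulus one have equal
algebraic and geometric multiplicities. -/
def MarginallyStable {d : ℕ} (A : Matrix (Fin d) (Fin d) ℝ) : Prop :=
  (∀ z : ℂ, (complexEnd A).HasEigenvalue z → ‖z‖ ≤ 1) ∧
  (∀ z : ℂ, (complexEnd A).HasEigenvalue z → ‖z‖ = 1 →
    (A.map Complex.ofReal).charpoly.rootMultiplicity z =
      Module.finrank ℂ ((complexEnd A).eigenspace z))

/-- Some linear state feedback `u = K x` makes the closed loop `A + B K` Schur stable. -/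
def Stabilizable {d m : ℕ} (A : Matrix (Fin d) (Fin d) ℝ) (B : Matrix (Fin d) (Fin m) ℝ) : Prop :=
  ∃ K : Matrix (Fin m) (Fin d) ℝ, SchurStable (A + B * K)

/-- The component of `x` along the eigenvalues of `A` outside the open unit disk is zero: `x` lies
in the sum of the generalized eigenspaces of the eigenvalues in the open unit disk. When all
eigenvalues lie in the closed unit disk, `ℂᵈ` is the direct sum of this space and of the sum of the
generalized eigenspaces of the unit-modulus eigenvalues, so that this says that the unit-circle
part of `x` vanishes. -/
def UnitCirclePartVanishes {d : ℕ} (A : Matrix (Fin d) (Fin d) ℝ) (x : RVec d) : Prop :=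
  (fun i => (x i : ℂ)) ∈ ⨆ z : ℂ, ⨆ _ : ‖z‖ < 1, (complexEnd A).maxGenEigenspace z

/-- A deterministic `k`-history-dependent policy: a measurable map for each time; its argument `h`
is the history with `h 0 = x_t`, `h 1 = x_{t-1}`, ..., `h (k-1) = x_{t-k+1}`. -/
structure HistoryPolicy (d m k : ℕ) where
  act : ℕ → (Fin k → RVec d) → RVec m
  measurable_act : ∀ t, Measurable (act t)

/-- The policy is the successive concatenation of one sequence `f_0, ..., f_{k-1}` of maps of the
state, applied in this order to the first state of each time segment of length `k`:
`u_t = f_{t mod k} (x_{t - t mod k})`. -/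
def HistoryPolicy.IsConcatenation {d m k : ℕ} (p : HistoryPolicy d m k) : Prop :=
  ∃ f : Fin k → RVec d → RVec m, ∀ (t : ℕ) (i : Fin k), (i : ℕ) = t % k →
    ∀ h : Fin k → RVec d, p.act t h = f i (h i)

/-- The solution of `x_{t+1} = A x_t + B π_t(x_t, x_{t-1}, ..., x_{t-k+1}) + v_t`, `x_0 = x`.
Subtraction of natural numbers is truncated, which is the convention
`x_{-k+1} = ... = x_{-1} = x_0`. -/
def closedLoop {d m k : ℕ} (A : Matrix (Fin d) (Fin d) ℝ) (B : Matrix (Fin d) (Fin m) ℝ)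
    (p : HistoryPolicy d m k) (v : ℕ → RVec d) (x : RVec d) : ℕ → RVec d
  | 0 => x
  | t + 1 => Matrix.toEuclideanLin A (closedLoop A B p v x t)
      + Matrix.toEuclideanLin B (p.act t fun i => closedLoop A B p v x (t - (i : ℕ))) + v t

theorem closedLoop_zero {d m k : ℕ} (A : Matrix (Fin d) (Fin d) ℝ) (B : Matrix (Fin d) (Fin m) ℝ)
    (p : HistoryPolicy d m k) (v : ℕ → RVec d) (x : RVec d) : closedLoop A B p v x 0 = x := by
  rw [closedLoop]

theorem closedLoop_succ {d m k : ℕ} (A : Matrix (Fin d) (Fin d) ℝ) (B : Matrix (Fin d) (Fin m) ℝ)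
    (p : HistoryPolicy d m k) (v : ℕ → RVec d) (x : RVec d) (t : ℕ) :
    closedLoop A B p v x (t + 1) = Matrix.toEuclideanLin A (closedLoop A B p v x t)
      + Matrix.toEuclideanLin B (p.act t fun i => closedLoop A B p v x (t - (i : ℕ))) + v t := by
  rw [closedLoop]

/-- For the family `φ x : ℕ → ℝᵈ` of trajectories indexed by the initial state `x`, the origin is
Lyapunov stable and attracts every trajectory. -/
def OriginAsymptoticallyStable {d : ℕ} (φ : RVec d → ℕ → RVec d) : Prop :=
  (∀ ε > 0, ∃ δ > 0, ∀ x, ‖x‖ < δ → ∀ t, ‖φ x t‖ < ε) ∧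
  (∀ x, Tendsto (φ x) atTop (𝓝 0))

end

/-! Split `ℝᵈ` into the `A`-invariant parts belonging to eigenvalues of modulus one and of modulus
less than one. Semisimplicity on the unit circle bounds the powers of `A` there, so some seminorm
`circle` does not increase under `A`. A second seminorm, `stable`, is contracted, and `circle +
stable` dominates the norm.

Stabilizability makes the circle part reachable in `d` steps (`Stabilizable.mem_range_reachMap`). If
`A ^ n y_n = x` with `y_n` bounded, then `(A + B K) ^ n y_n → 0`. Since `A` and `A + B K` agree
modulo the reachable space, `x` is a limit of reachable vectors. Hence the `d` inputs of a segment
can cancel any multiple of the circle part of the predicted state `A ^ d x`. Saturating this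
multiple keeps the inputs bounded and lowers `circle` by `r`, or to zero, per segment. Without
noise, `circle` vanishes after finitely many segments, the inputs stop, and the stable part decays.

With noise, `max circle r` at segment starts moves by at most an increment independent of the
present state. For large `r` this increment has mean at most `-1`, and its fourth moment is bounded.
Such a process has tail `min 1 (K / v) ^ 3` uniformly in time (`measure_le_cubicTail_of_drift`),
which is enough for second moments. Times inside a segment add at most `d` bounded inputs and
noises, and the stable part is a contraction driven by square-integrable terms. -/

/-- An endomorphism of a finite-dimensional complex normed space all of whose eigenvalues lie in
the open unit disk has geometrically decaying powers. -/
theorem exists_norm_pow_apply_le_of_eigenvalue_lt_one {V : Type*} [NormedAddCommGroup V]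
    [NormedSpace ℂ V] [FiniteDimensional ℂ V] (T : Module.End ℂ V)
    (hT : ∀ z, T.HasEigenvalue z → ‖z‖ < 1) :
    ∃ C ρ : ℝ, 0 ≤ C ∧ 0 < ρ ∧ ρ < 1 ∧ ∀ (n : ℕ) (v : V), ‖(T ^ n) v‖ ≤ C * ρ ^ n * ‖v‖ := by
  rcases subsingleton_or_nontrivial V with hV | hV
  · exact ⟨0, 1 / 2, le_rfl, by norm_num, by norm_num, fun n v => by
      simp [Subsingleton.elim ((T ^ n) v) 0]⟩
  have : CompleteSpace V := FiniteDimensional.complete ℂ V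
  let e : Module.End ℂ V ≃ₐ[ℂ] (V →L[ℂ] V) := Module.End.toContinuousLinearMap V
  set a : V →L[ℂ] V := e T with ha
  have hpow : ∀ n v, (a ^ n) v = (T ^ n) v := by
    intro n v
    rw [ha, ← map_pow]
    rfl
  have hrad : spectralRadius ℂ a < ((1 : NNReal) : ℝ≥0∞) := by
    refine spectrum.spectralRadius_lt_of_forall_lt a fun z hz => ?_
    rw [ha, AlgEquiv.spectrum_eq] at hz
    exact_mod_cast hT z (Module.End.hasEigenvalue_iff_mem_spectrum.2 hz)
  obtain ⟨ρ, hρ1, hρ2⟩ := ENNReal.lt_iff_exists_nnreal_btwn.1 hrad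
  have hρ2' : ρ < 1 := by exact_mod_cast hρ2
  -- Gelfand's formula, with `ρ` chosen strictly between the spectral radius and one.
  have hev := (spectrum.pow_nnnorm_pow_one_div_tendsto_nhds_spectralRadius a).eventually_lt_const hρ1
  have hρ0 : 0 < ρ := by
    have : (0 : ℝ≥0∞) < ρ := lt_of_le_of_lt zero_le hρ1
    exact_mod_cast this
  have hev' : ∀ᶠ n : ℕ in atTop, ‖a ^ n‖ ≤ (ρ : ℝ) ^ n := by
    filter_upwards [hev, eventually_ge_atTop 1] with n hn hn1
    have hn0 : (0 : ℝ) < n := by exact_mod_cast hn1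
    have h1 := ENNReal.rpow_le_rpow hn.le hn0.le
    rw [← ENNReal.rpow_mul, one_div_mul_cancel hn0.ne', ENNReal.rpow_one, ENNReal.rpow_natCast] at h1
    exact_mod_cast h1
  obtain ⟨n₀, hn₀⟩ := eventually_atTop.1 hev'
  have hρ0' : (0 : ℝ) < ρ := by exact_mod_cast hρ0
  -- The `1` serves the exponents from `n₀` on; the sum absorbs the finitely many earlier ones.
  set C : ℝ := 1 + ∑ i ∈ Finset.range n₀, ‖a ^ i‖ / (ρ : ℝ) ^ i with hC
  have hterm : ∀ i, 0 ≤ ‖a ^ i‖ / (ρ : ℝ) ^ i := fun i => by positivity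
  have hC1 : 1 ≤ C := by
    have := Finset.sum_nonneg (s := Finset.range n₀) fun i _ => hterm i
    linarith
  refine ⟨C, ρ, by linarith, hρ0', by exact_mod_cast hρ2', fun n v => ?_⟩
  rw [← hpow]
  refine (ContinuousLinearMap.le_opNorm _ _).trans (mul_le_mul_of_nonneg_right ?_ (norm_nonneg _))
  have hpn : (0 : ℝ) < (ρ : ℝ) ^ n := by positivity
  rcases le_or_gt n₀ n with hn | hn
  · refine (hn₀ n hn).trans ?_
    nlinarith
  · have h1 : ‖a ^ n‖ / (ρ : ℝ) ^ n ≤ C := by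
      have := Finset.single_le_sum (f := fun i => ‖a ^ i‖ / (ρ : ℝ) ^ i)
        (fun i _ => hterm i) (Finset.mem_range.2 hn)
      linarith
    rwa [div_le_iff₀ hpn] at h1

theorem maxGenEigenspace_eq_bot {K V : Type*} [Field K] [AddCommGroup V] [Module K V]
    {f : Module.End K V} {z : K} (hz : ¬ f.HasEigenvalue z) : f.maxGenEigenspace z = ⊥ := by
  by_contra hne
  exact hz (Module.End.HasUnifEigenvalue.lt (k := ⊤) zero_lt_one hne)

/-! ### Sums of generalized eigenspaces over `ℂ` -/

section SpectralPart

variable {d : ℕ}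

/-- The sum of the generalized eigenspaces of `A` for the eigenvalues satisfying `p`. -/
noncomputable def spectralPart (A : Matrix (Fin d) (Fin d) ℝ) (p : ℂ → Prop) :
    Submodule ℂ (Fin d → ℂ) :=
  ⨆ z : ℂ, ⨆ _ : p z, (complexEnd A).maxGenEigenspace z

theorem complexEnd_apply_mem_spectralPart (A : Matrix (Fin d) (Fin d) ℝ) (p : ℂ → Prop)
    {v : Fin d → ℂ} (hv : v ∈ spectralPart A p) : complexEnd A v ∈ spectralPart A p := by
  have h : spectralPart A p ≤ (spectralPart A p).comap (complexEnd A) := by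
    refine iSup₂_le fun z hz v hv => ?_
    exact (le_iSup₂_of_le (f := fun z (_ : p z) => (complexEnd A).maxGenEigenspace z) z hz le_rfl)
      (Module.End.mapsTo_maxGenEigenspace_of_comm (Commute.refl (complexEnd A)) z hv)
  exact h hv

theorem complexEnd_star (A : Matrix (Fin d) (Fin d) ℝ) (v : Fin d → ℂ) :
    complexEnd A (star v) = star (complexEnd A v) := by
  ext i
  simp [complexEnd, Matrix.toLin'_apply, Matrix.mulVec, dotProduct]

theorem complexEnd_sub_pow_star (A : Matrix (Fin d) (Fin d) ℝ) (z : ℂ) (k : ℕ) (v : Fin d → ℂ) :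
    ((complexEnd A - (star z) • (1 : Module.End ℂ (Fin d → ℂ))) ^ k) (star v)
      = star (((complexEnd A - z • (1 : Module.End ℂ (Fin d → ℂ))) ^ k) v) := by
  induction k generalizing v with
  | zero => simp
  | succ k ih =>
    rw [pow_succ, pow_succ, Module.End.mul_apply, Module.End.mul_apply, ← ih]
    congr 1
    simp [complexEnd_star]

/-- `A` is real, so conjugation exchanges the generalized eigenspaces at `z` and at its conjugate.
This lets the splitting descend to `ℝᵈ`. -/
theorem star_mem_spectralPart (A : Matrix (Fin d) (Fin d) ℝ) {p : ℂ → Prop}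
    (hp : ∀ z, p z → p (star z)) {v : Fin d → ℂ} (hv : v ∈ spectralPart A p) :
    star v ∈ spectralPart A p := by
  have h : spectralPart A p ≤
      (spectralPart A p).comap (starLinearEquiv ℂ (A := Fin d → ℂ)).toLinearMap := by
    refine iSup₂_le fun z hz v hv => ?_
    refine (le_iSup₂_of_le (f := fun z (_ : p z) => (complexEnd A).maxGenEigenspace z)
      (star z) (hp z hz) le_rfl) ?_
    rw [Module.End.mem_maxGenEigenspace] at hv ⊢
    obtain ⟨k, hk⟩ := hv
    exact ⟨k, by
      have := complexEnd_sub_pow_star A z k v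
      rw [hk, star_zero] at this
      exact this⟩
  exact h hv

theorem disjoint_spectralPart (A : Matrix (Fin d) (Fin d) ℝ) {p q : ℂ → Prop}
    (h : ∀ z, p z → ¬ q z) : Disjoint (spectralPart A p) (spectralPart A q) := by
  have := (complexEnd A).independent_maxGenEigenspace.disjoint_biSup_biSup
    (s := {z | p z}) (t := {z | q z}) (Set.disjoint_left.2 h)
  simpa [spectralPart] using this

theorem spectralPart_sup_spectralPart_eq_top (A : Matrix (Fin d) (Fin d) ℝ) {p q : ℂ → Prop}
    (h : ∀ z, (complexEnd A).HasEigenvalue z → p z ∨ q z) :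
    spectralPart A p ⊔ spectralPart A q = ⊤ := by
  rw [eq_top_iff, ← Module.End.iSup_maxGenEigenspace_eq_top (complexEnd A)]
  refine iSup_le fun z => ?_
  by_cases hz : (complexEnd A).HasEigenvalue z
  · rcases h z hz with hz | hz
    · exact le_sup_of_le_left
        (le_iSup₂_of_le (f := fun z (_ : p z) => (complexEnd A).maxGenEigenspace z) z hz le_rfl)
    · exact le_sup_of_le_right
        (le_iSup₂_of_le (f := fun z (_ : q z) => (complexEnd A).maxGenEigenspace z) z hz le_rfl)
  · simp [maxGenEigenspace_eq_bot hz]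

/-- Powers decay geometrically on the part of the spectrum in the open unit disk. -/
theorem exists_norm_pow_apply_le_of_mem_spectralPart (A : Matrix (Fin d) (Fin d) ℝ) :
    ∃ C ρ : ℝ, 0 ≤ C ∧ 0 < ρ ∧ ρ < 1 ∧ ∀ (n : ℕ), ∀ v ∈ spectralPart A (fun z => ‖z‖ < 1),
      ‖(complexEnd A ^ n) v‖ ≤ C * ρ ^ n * ‖v‖ := by
  set S := spectralPart A (fun z => ‖z‖ < 1) with hS
  have hinv : ∀ v ∈ S, complexEnd A v ∈ S := fun v hv => complexEnd_apply_mem_spectralPart A _ hv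
  let T : Module.End ℂ S := (complexEnd A).restrict hinv
  obtain ⟨C, ρ, hC, hρ, hρ1, hT⟩ := exists_norm_pow_apply_le_of_eigenvalue_lt_one T fun z hz => by
    obtain ⟨v, hv⟩ := hz.exists_hasEigenvector
    have hv1 : complexEnd A v = z • (v : Fin d → ℂ) := congrArg Subtype.val hv.apply_eq_smul
    -- An eigenvector of the restriction with `1 ≤ ‖z‖` would lie in two independent spectral parts
    -- at once.
    by_contra hz1
    have hmem : (v : Fin d → ℂ) ∈ spectralPart A (fun z => ¬ ‖z‖ < 1) := by
      refine (le_iSup₂_of_le (f := fun z (_ : ¬ ‖z‖ < 1) => (complexEnd A).maxGenEigenspace z)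
        z hz1 le_rfl) ?_
      rw [Module.End.mem_maxGenEigenspace]
      exact ⟨1, by simp [hv1]⟩
    have := (disjoint_spectralPart A (p := fun z => ‖z‖ < 1) (q := fun z => ¬ ‖z‖ < 1)
      (fun z h => not_not.2 h)).le_bot ⟨v.2, hmem⟩
    exact hv.2 (Subtype.ext ((Submodule.mem_bot ℂ).1 this))
  have hval : ∀ (n : ℕ) (v : S), ((T ^ n) v : Fin d → ℂ) = (complexEnd A ^ n) v := by
    intro n
    induction n with
    | zero => simp
    | succ n ih =>
      intro v
      rw [pow_succ, pow_succ, Module.End.mul_apply, Module.End.mul_apply, ih]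
      rfl
  refine ⟨C, ρ, hC, hρ, hρ1, fun n v hv => ?_⟩
  have := hT n ⟨v, hv⟩
  rw [Submodule.coe_norm, hval] at this
  exact this

/-- The dimension of the generalized eigenspace is the algebraic multiplicity, so equal
multiplicities turn the inclusion of the eigenspace into equality. -/
theorem MarginallyStable.maxGenEigenspace_eq_eigenspace {A : Matrix (Fin d) (Fin d) ℝ}
    (hA : MarginallyStable A) {z : ℂ} (hz : ‖z‖ = 1) :
    (complexEnd A).maxGenEigenspace z = (complexEnd A).eigenspace z := by
  have hle : (complexEnd A).eigenspace z ≤ (complexEnd A).maxGenEigenspace z :=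
    (complexEnd A).genEigenspace z |>.mono le_top
  by_cases he : (complexEnd A).HasEigenvalue z
  · refine (Submodule.eq_of_le_of_finrank_eq hle ?_).symm
    rw [LinearMap.finrank_maxGenEigenspace_eq, ← hA.2 z he hz]
    congr 1
    rw [complexEnd, Matrix.charpoly_toLin']
  · rw [maxGenEigenspace_eq_bot he] at hle ⊢
    exact (le_bot_iff.1 hle).symm

/-- On the unit-circle part a marginally stable matrix has bounded forward and backward orbits. -/
theorem MarginallyStable.exists_orbit_bound {A : Matrix (Fin d) (Fin d) ℝ}
    (hA : MarginallyStable A) {v : Fin d → ℂ} (hv : v ∈ spectralPart A (fun z => ‖z‖ = 1)) :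
    ∃ C : ℝ, ∀ n : ℕ, ‖(complexEnd A ^ n) v‖ ≤ C ∧
      ∃ y, (complexEnd A ^ n) y = v ∧ ‖y‖ ≤ C := by
  rw [spectralPart, iSup_subtype'] at hv
  -- The property is additive, so one eigenspace suffices; there `A ^ n` acts as a scalar of modulus
  -- one, in both time directions.
  refine Submodule.iSup_induction (motive := fun v => ∃ C : ℝ, ∀ n : ℕ, ‖(complexEnd A ^ n) v‖ ≤ C ∧
      ∃ y, (complexEnd A ^ n) y = v ∧ ‖y‖ ≤ C) _ hv ?_ ?_ ?_
  · rintro ⟨z, hz⟩ v hv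
    simp only at hv
    rw [hA.maxGenEigenspace_eq_eigenspace hz, Module.End.mem_eigenspace_iff] at hv
    have hpow : ∀ n : ℕ, (complexEnd A ^ n) v = z ^ n • v := by
      intro n
      induction n with
      | zero => simp
      | succ n ih => rw [pow_succ', Module.End.mul_apply, ih, map_smul, hv, smul_smul, pow_succ]
    have hz0 : z ≠ 0 := by
      rintro rfl
      simp at hz
    refine ⟨‖v‖, fun n => ⟨by simp [hpow, norm_smul, hz], (z ^ n)⁻¹ • v, ?_, ?_⟩⟩
    · rw [map_smul, hpow, smul_smul, inv_mul_cancel₀ (pow_ne_zero n hz0), one_smul]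
    · simp [norm_smul, hz]
  · exact ⟨0, fun n => ⟨by simp, 0, by simp, by simp⟩⟩
  · rintro v w ⟨C, hC⟩ ⟨D, hD⟩
    refine ⟨C + D, fun n => ⟨?_, ?_⟩⟩
    · rw [map_add]
      exact norm_add_le_of_le (hC n).1 (hD n).1
    · obtain ⟨y, hy, hyC⟩ := (hC n).2
      obtain ⟨x, hx, hxC⟩ := (hD n).2
      exact ⟨y + x, by rw [map_add, hy, hx], norm_add_le_of_le hyC hxC⟩

end SpectralPart

/-! ### Descent of the spectral splitting to `ℝᵈ` -/

section RealStructure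

variable {d : ℕ}

/-- The inclusion of `ℝᵈ` in `ℂᵈ`. -/
noncomputable def complexify (d : ℕ) : RVec d →ₗ[ℝ] (Fin d → ℂ) where
  toFun x i := (x i : ℂ)
  map_add' x y := by ext i; simp
  map_smul' c x := by ext i; simp

/-- The coordinatewise real part `ℂᵈ → ℝᵈ`. -/
noncomputable def coordRe (d : ℕ) : (Fin d → ℂ) →ₗ[ℝ] RVec d where
  toFun v := WithLp.toLp 2 fun i => (v i).re
  map_add' x y := by ext i; simp
  map_smul' c x := by ext i; simp

theorem complexify_apply (x : RVec d) (i : Fin d) : complexify d x i = (x i : ℂ) := rfl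

theorem coordRe_apply (v : Fin d → ℂ) (i : Fin d) : coordRe d v i = (v i).re := rfl

theorem coordRe_complexify (x : RVec d) : coordRe d (complexify d x) = x := by
  ext i; simp [coordRe_apply, complexify_apply]

theorem complexify_coordRe (v : Fin d → ℂ) :
    complexify d (coordRe d v) = (2⁻¹ : ℂ) • (v + star v) := by
  ext i
  simp [coordRe_apply, complexify_apply, Complex.re_eq_add_conj]
  ring

theorem complexify_toEuclideanLin (A : Matrix (Fin d) (Fin d) ℝ) (x : RVec d) :
    complexify d (Matrix.toEuclideanLin A x) = complexEnd A (complexify d x) := by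
  ext i
  simp [complexify_apply, complexEnd, Matrix.toLin'_apply, Matrix.mulVec, dotProduct,
    Matrix.toEuclideanLin]

theorem coordRe_complexEnd (A : Matrix (Fin d) (Fin d) ℝ) (v : Fin d → ℂ) :
    coordRe d (complexEnd A v) = Matrix.toEuclideanLin A (coordRe d v) := by
  ext i
  simp [coordRe_apply, complexEnd, Matrix.toLin'_apply, Matrix.mulVec, dotProduct,
    Matrix.toEuclideanLin]

theorem coordRe_complexEnd_pow (A : Matrix (Fin d) (Fin d) ℝ) (n : ℕ) (v : Fin d → ℂ) :
    coordRe d ((complexEnd A ^ n) v) = (Matrix.toEuclideanLin A ^ n) (coordRe d v) := by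
  induction n generalizing v with
  | zero => simp
  | succ n ih => rw [pow_succ, pow_succ, Module.End.mul_apply, Module.End.mul_apply, ih,
      coordRe_complexEnd]

theorem exists_norm_coordRe_le (d : ℕ) : ∃ C : ℝ, 0 ≤ C ∧ ∀ v, ‖coordRe d v‖ ≤ C * ‖v‖ :=
  ⟨‖(coordRe d).toContinuousLinearMap‖, norm_nonneg _,
    fun v => (coordRe d).toContinuousLinearMap.le_opNorm v⟩

theorem exists_norm_complexify_le (d : ℕ) : ∃ C : ℝ, 0 ≤ C ∧ ∀ x, ‖complexify d x‖ ≤ C * ‖x‖ :=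
  ⟨‖(complexify d).toContinuousLinearMap‖, norm_nonneg _,
    fun v => (complexify d).toContinuousLinearMap.le_opNorm v⟩

/-- The real points of the spectral part. -/
noncomputable def realSpectralPart (A : Matrix (Fin d) (Fin d) ℝ) (p : ℂ → Prop) :
    Submodule ℝ (RVec d) :=
  ((spectralPart A p).restrictScalars ℝ).comap (complexify d)

theorem mem_realSpectralPart {A : Matrix (Fin d) (Fin d) ℝ} {p : ℂ → Prop} {x : RVec d} :
    x ∈ realSpectralPart A p ↔ complexify d x ∈ spectralPart A p := Iff.rfl

theorem toEuclideanLin_mem_realSpectralPart {A : Matrix (Fin d) (Fin d) ℝ} {p : ℂ → Prop}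
    {x : RVec d} (hx : x ∈ realSpectralPart A p) :
    Matrix.toEuclideanLin A x ∈ realSpectralPart A p := by
  rw [mem_realSpectralPart, complexify_toEuclideanLin]
  exact complexEnd_apply_mem_spectralPart A p hx

/-- Decompose over `ℂ` and take real parts: the real part is the average of a vector and its
conjugate, hence stays in a conjugation-invariant spectral part. -/
theorem isCompl_realSpectralPart (A : Matrix (Fin d) (Fin d) ℝ) {p q : ℂ → Prop}
    (hp : ∀ z, p z → p (star z)) (hq : ∀ z, q z → q (star z)) (hpq : ∀ z, p z → ¬ q z)
    (h : ∀ z, (complexEnd A).HasEigenvalue z → p z ∨ q z) :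
    IsCompl (realSpectralPart A p) (realSpectralPart A q) := by
  have hre : ∀ {p : ℂ → Prop}, (∀ z, p z → p (star z)) → ∀ v ∈ spectralPart A p,
      coordRe d v ∈ realSpectralPart A p := by
    intro p hp v hv
    rw [mem_realSpectralPart, complexify_coordRe]
    exact Submodule.smul_mem _ _ (Submodule.add_mem _ hv (star_mem_spectralPart A hp hv))
  constructor
  · rw [Submodule.disjoint_def]
    intro x hx hy
    have := (Submodule.disjoint_def.1 (disjoint_spectralPart A hpq)) _ hx hy
    rw [← coordRe_complexify x, this, map_zero]
  · rw [codisjoint_iff, eq_top_iff]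
    intro x _
    have hx : complexify d x ∈ spectralPart A p ⊔ spectralPart A q := by
      rw [spectralPart_sup_spectralPart_eq_top A h]
      trivial
    obtain ⟨s, hs, u, hu, hsu⟩ := Submodule.mem_sup.1 hx
    refine Submodule.mem_sup.2 ⟨coordRe d s, hre hp s hs, coordRe d u, hre hq u hu, ?_⟩
    rw [← map_add, hsu, coordRe_complexify]

end RealStructure

/-! ### Projection onto the circle part and adapted seminorms -/

section Splitting

variable {d m : ℕ}

/-- A Schur stable matrix has geometrically decaying powers. -/
theorem SchurStable.exists_norm_pow_apply_le {F : Matrix (Fin d) (Fin d) ℝ} (hF : SchurStable F) :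
    ∃ C ρ : ℝ, 0 ≤ C ∧ 0 < ρ ∧ ρ < 1 ∧
      ∀ (n : ℕ) (x : RVec d), ‖(Matrix.toEuclideanLin F ^ n) x‖ ≤ C * ρ ^ n * ‖x‖ := by
  obtain ⟨C, ρ, hC, hρ, hρ1, h⟩ := exists_norm_pow_apply_le_of_eigenvalue_lt_one (complexEnd F) hF
  obtain ⟨a, ha, hre⟩ := exists_norm_coordRe_le d
  obtain ⟨b, hb, hco⟩ := exists_norm_complexify_le d
  refine ⟨a * C * b, ρ, by positivity, hρ, hρ1, fun n x => ?_⟩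
  rw [← coordRe_complexify x, ← coordRe_complexEnd_pow, coordRe_complexify]
  calc _ ≤ a * (C * ρ ^ n * (b * ‖x‖)) := (hre _).trans (mul_le_mul_of_nonneg_left
        ((h n _).trans (mul_le_mul_of_nonneg_left (hco x) (by positivity))) ha)
    _ = _ := by ring

/-- The projection onto the unit-circle part along the stable part. -/
theorem MarginallyStable.exists_projection {A : Matrix (Fin d) (Fin d) ℝ}
    (hA : MarginallyStable A) :
    ∃ P : Module.End ℝ (RVec d),
      (∀ x, P (Matrix.toEuclideanLin A x) = Matrix.toEuclideanLin A (P x)) ∧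
      (∀ x, P (P x) = P x) ∧
      (∀ x, ∃ C : ℝ, ∀ n : ℕ, ‖(Matrix.toEuclideanLin A ^ n) (P x)‖ ≤ C ∧
        ∃ y, (Matrix.toEuclideanLin A ^ n) y = P x ∧ ‖y‖ ≤ C) ∧
      (∃ C ρ : ℝ, 0 ≤ C ∧ 0 < ρ ∧ ρ < 1 ∧ ∀ (n : ℕ) (x : RVec d),
        ‖(Matrix.toEuclideanLin A ^ n) (x - P x)‖ ≤ C * ρ ^ n * ‖x‖) ∧
      (∀ x, P x = 0 → UnitCirclePartVanishes A x) := by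
  have hc : IsCompl (realSpectralPart A fun z => ‖z‖ = 1) (realSpectralPart A fun z => ‖z‖ < 1) :=
    isCompl_realSpectralPart A (fun z hz => by simpa using hz) (fun z hz => by simpa using hz)
      (fun z hz => by rw [hz]; exact lt_irrefl _) fun z hz => (hA.1 z hz).eq_or_lt
  set P := (realSpectralPart A fun z => ‖z‖ = 1).projection _ hc with hP
  have hPmem : ∀ x, P x ∈ realSpectralPart A fun z => ‖z‖ = 1 :=
    fun x => Submodule.projection_apply_mem hc x
  have hQmem : ∀ x, x - P x ∈ realSpectralPart A fun z => ‖z‖ < 1 := by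
    intro x
    rw [← Submodule.projection_apply_eq_zero_iff hc, map_sub,
      Submodule.projection_apply_of_mem_left hc (hPmem x), sub_self]
  refine ⟨P, fun x => ?_, fun x => Submodule.projection_apply_of_mem_left hc (hPmem x),
    fun x => ?_, ?_, fun x hx => ?_⟩
  · have h1 : P (Matrix.toEuclideanLin A (P x)) = Matrix.toEuclideanLin A (P x) :=
      Submodule.projection_apply_of_mem_left hc (toEuclideanLin_mem_realSpectralPart (hPmem x))
    have h2 : P (Matrix.toEuclideanLin A (x - P x)) = 0 :=
      (Submodule.projection_apply_eq_zero_iff hc).2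
        (toEuclideanLin_mem_realSpectralPart (hQmem x))
    rw [map_sub, map_sub, sub_eq_zero] at h2
    rw [h2, h1]
  · obtain ⟨C, h⟩ := hA.exists_orbit_bound (hPmem x)
    obtain ⟨a, ha, hre⟩ := exists_norm_coordRe_le d
    refine ⟨a * C, fun n => ⟨?_, ?_⟩⟩
    · rw [← coordRe_complexify (P x), ← coordRe_complexEnd_pow]
      exact (hre _).trans (mul_le_mul_of_nonneg_left (h n).1 ha)
    · obtain ⟨y, hy, hyC⟩ := (h n).2
      refine ⟨coordRe d y, ?_, (hre _).trans (mul_le_mul_of_nonneg_left hyC ha)⟩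
      rw [← coordRe_complexEnd_pow, hy, coordRe_complexify]
  · obtain ⟨C, ρ, hC, hρ, hρ1, h⟩ := exists_norm_pow_apply_le_of_mem_spectralPart A
    obtain ⟨a, ha, hre⟩ := exists_norm_coordRe_le d
    obtain ⟨b, hb, hco⟩ := exists_norm_complexify_le d
    let Q : RVec d →L[ℝ] RVec d := LinearMap.toContinuousLinearMap (LinearMap.id - P)
    refine ⟨a * C * b * ‖Q‖, ρ, by positivity, hρ, hρ1, fun n x => ?_⟩
    have hQ : ‖x - P x‖ ≤ ‖Q‖ * ‖x‖ := Q.le_opNorm x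
    have hcQ : ‖complexify d (x - P x)‖ ≤ b * (‖Q‖ * ‖x‖) :=
      (hco _).trans (mul_le_mul_of_nonneg_left hQ hb)
    rw [← coordRe_complexify (x - P x), ← coordRe_complexEnd_pow]
    calc _ ≤ a * (C * ρ ^ n * (b * (‖Q‖ * ‖x‖))) := (hre _).trans (mul_le_mul_of_nonneg_left
          ((h n _ (hQmem x)).trans (mul_le_mul_of_nonneg_left hcQ (by positivity))) ha)
      _ = _ := by ring
  · exact (Submodule.projection_apply_eq_zero_iff hc).1 hx

/-- A seminorm contracted by `T` at the rate at which the powers of `T` decay on the range of a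
commuting endomorphism `Q`. -/
theorem exists_contracted_seminorm {E : Type*} [NormedAddCommGroup E] [NormedSpace ℝ E]
    (T Q : Module.End ℝ E) (hTQ : ∀ x, Q (T x) = T (Q x)) {C ρ : ℝ} (hρ : 0 < ρ)
    (h : ∀ (n : ℕ) x, ‖(T ^ n) (Q x)‖ ≤ C * ρ ^ n * ‖x‖) :
    ∃ N : Seminorm ℝ E, (∀ x, N (T x) ≤ ρ * N x) ∧ (∀ x, ‖Q x‖ ≤ N x) ∧
      (∀ x, N x ≤ C * ‖x‖) ∧ ∀ x, Q x = 0 → N x = 0 := by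
  have hle : ∀ x n, ‖(T ^ n) (Q x)‖ / ρ ^ n ≤ C * ‖x‖ := by
    intro x n
    rw [div_le_iff₀ (by positivity)]
    linarith [h n x, mul_right_comm C (ρ ^ n) ‖x‖]
  have hbdd : ∀ x, BddAbove (Set.range fun n : ℕ => ‖(T ^ n) (Q x)‖ / ρ ^ n) := by
    rintro x
    refine ⟨C * ‖x‖, ?_⟩
    rintro _ ⟨n, rfl⟩
    exact hle x n
  -- Applying `T` shifts the index of the supremum by one, at the price of a factor `ρ`. The term `n
  -- = 0` bounds `‖Q x‖`.
  let N : Seminorm ℝ E := Seminorm.ofSMulLE (fun x => ⨆ n : ℕ, ‖(T ^ n) (Q x)‖ / ρ ^ n)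
    (by simp)
    (fun x y => by
      refine ciSup_le fun n => ?_
      refine le_trans ?_ (add_le_add (le_ciSup (hbdd x) n) (le_ciSup (hbdd y) n))
      rw [← add_div, map_add, map_add]
      gcongr
      exact norm_add_le _ _)
    (fun c x => by
      refine ciSup_le fun n => ?_
      rw [map_smul, map_smul, norm_smul, mul_div_assoc]
      exact mul_le_mul_of_nonneg_left (le_ciSup (hbdd x) n) (norm_nonneg _))
  have hN : ∀ x, N x = ⨆ n : ℕ, ‖(T ^ n) (Q x)‖ / ρ ^ n := fun x => rfl
  refine ⟨N, fun x => ?_, fun x => ?_, fun x => ?_, fun x hx => ?_⟩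
  · rw [hN]
    refine ciSup_le fun n => ?_
    have := le_ciSup (hbdd x) (n + 1)
    rw [← hN, pow_succ, pow_succ, Module.End.mul_apply, ← hTQ, ← div_div,
      div_le_iff₀ hρ] at this
    linarith
  · rw [hN]
    simpa using le_ciSup (hbdd x) 0
  · rw [hN]
    exact ciSup_le (hle x)
  · simp [hN, hx]

end Splitting

/-! ### Reachability of the circle part -/

section Reachability

variable {d m : ℕ}

/-- The state reached from the origin in `d` steps under the given inputs. -/
noncomputable def reachMap (A : Matrix (Fin d) (Fin d) ℝ) (B : Matrix (Fin d) (Fin m) ℝ) :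
    (Fin d → RVec m) →ₗ[ℝ] RVec d :=
  ∑ i : Fin d, (Matrix.toEuclideanLin A ^ (d - 1 - (i : ℕ))) ∘ₗ
    Matrix.toEuclideanLin B ∘ₗ LinearMap.proj i

theorem reachMap_apply (A : Matrix (Fin d) (Fin d) ℝ) (B : Matrix (Fin d) (Fin m) ℝ)
    (u : Fin d → RVec m) : reachMap A B u = ∑ i : Fin d,
      (Matrix.toEuclideanLin A ^ (d - 1 - (i : ℕ))) (Matrix.toEuclideanLin B (u i)) := by
  simp [reachMap]

/-- Cayley–Hamilton: reducing `X ^ n` modulo the characteristic polynomial leaves only powers below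
`d`. -/
theorem pow_apply_mem_range_reachMap (A : Matrix (Fin d) (Fin d) ℝ) (B : Matrix (Fin d) (Fin m) ℝ)
    (n : ℕ) (u : RVec m) :
    (Matrix.toEuclideanLin A ^ n) (Matrix.toEuclideanLin B u) ∈ LinearMap.range (reachMap A B) := by
  have hlow : ∀ i < d, (Matrix.toEuclideanLin A ^ i) (Matrix.toEuclideanLin B u) ∈
      LinearMap.range (reachMap A B) := by
    intro i hi
    -- An input at time `j` is propagated `d - 1 - j` times, so the power `i` calls for time `d - 1
    -- - i`.
    refine ⟨Pi.single ⟨d - 1 - i, by omega⟩ u, ?_⟩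
    rw [reachMap_apply, Finset.sum_eq_single ⟨d - 1 - i, by omega⟩]
    · rw [Pi.single_eq_same]
      congr 2
      simp only
      omega
    · intro j _ hj
      rw [Pi.single_eq_of_ne hj]
      simp
    · simp
  rcases Nat.eq_zero_or_pos d with rfl | hd
  · rw [Subsingleton.elim ((Matrix.toEuclideanLin A ^ n) (Matrix.toEuclideanLin B u)) 0]
    exact Submodule.zero_mem _
  let T : Module.End ℝ (RVec d) := Matrix.toEuclideanLin A
  have hdeg : (Polynomial.X ^ n %ₘ T.charpoly).natDegree < d := by
    have h1 := LinearMap.charpoly_natDegree T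
    rw [finrank_euclideanSpace_fin] at h1
    have h2 := Polynomial.natDegree_modByMonic_lt (Polynomial.X ^ n) (LinearMap.charpoly_monic T)
      (by
        intro h
        rw [h, Polynomial.natDegree_one] at h1
        omega)
    omega
  change (T ^ n) _ ∈ _
  rw [LinearMap.pow_eq_aeval_mod_charpoly, Polynomial.aeval_eq_sum_range' hdeg,
    LinearMap.sum_apply]
  refine Submodule.sum_mem _ fun i hi => ?_
  rw [LinearMap.smul_apply]
  exact Submodule.smul_mem _ _ (hlow i (Finset.mem_range.1 hi))

theorem toEuclideanLin_mem_range_reachMap {A : Matrix (Fin d) (Fin d) ℝ}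
    {B : Matrix (Fin d) (Fin m) ℝ} {x : RVec d} (hx : x ∈ LinearMap.range (reachMap A B)) :
    Matrix.toEuclideanLin A x ∈ LinearMap.range (reachMap A B) := by
  obtain ⟨u, rfl⟩ := hx
  rw [reachMap_apply, map_sum]
  refine Submodule.sum_mem _ fun i _ => ?_
  rw [← Module.End.mul_apply, ← pow_succ']
  exact pow_apply_mem_range_reachMap A B _ _

/-- Feedback only adds vectors from the range of `B`, and the reachable space is `A`-invariant;
modulo it the two dynamics coincide. -/
theorem pow_sub_feedback_pow_mem_range_reachMap (A : Matrix (Fin d) (Fin d) ℝ)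
    (B : Matrix (Fin d) (Fin m) ℝ) (K : Matrix (Fin m) (Fin d) ℝ) (n : ℕ) (y : RVec d) :
    (Matrix.toEuclideanLin A ^ n) y - (Matrix.toEuclideanLin (A + B * K) ^ n) y ∈
      LinearMap.range (reachMap A B) := by
  induction n with
  | zero => simp
  | succ n ih =>
    have hF : ∀ x, Matrix.toEuclideanLin (A + B * K) x = Matrix.toEuclideanLin A x +
        Matrix.toEuclideanLin B (Matrix.toEuclideanLin K x) := by
      intro x
      ext i
      simp [Matrix.toEuclideanLin]
    rw [pow_succ', pow_succ', Module.End.mul_apply, Module.End.mul_apply, hF, ← sub_sub, ← map_sub]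
    refine Submodule.sub_mem _ (toEuclideanLin_mem_range_reachMap ih) ?_
    exact pow_apply_mem_range_reachMap A B 0 _

/-- Under stabilizability every state with a bounded backward orbit is reachable. -/
theorem Stabilizable.mem_range_reachMap {A : Matrix (Fin d) (Fin d) ℝ}
    {B : Matrix (Fin d) (Fin m) ℝ} (hAB : Stabilizable A B) {x : RVec d}
    (hx : ∃ C : ℝ, ∀ n : ℕ, ∃ y, (Matrix.toEuclideanLin A ^ n) y = x ∧ ‖y‖ ≤ C) :
    x ∈ LinearMap.range (reachMap A B) := by
  obtain ⟨K, hK⟩ := hAB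
  obtain ⟨c, ρ, hc, hρ, hρ1, hF⟩ := hK.exists_norm_pow_apply_le
  obtain ⟨C, hC⟩ := hx
  choose y hy hyC using hC
  have hlim : Tendsto (fun n => (Matrix.toEuclideanLin (A + B * K) ^ n) (y n)) atTop (𝓝 0) := by
    refine squeeze_zero_norm (a := fun n => c * ρ ^ n * C) (fun n => ?_) ?_
    · exact (hF n _).trans (mul_le_mul_of_nonneg_left (hyC n) (by positivity))
    · simpa using ((tendsto_pow_atTop_nhds_zero_of_lt_one hρ.le hρ1).const_mul c).mul_const C
  have hclosed : IsClosed (LinearMap.range (reachMap A B) : Set (RVec d)) :=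
    Submodule.closed_of_finiteDimensional _
  refine hclosed.mem_of_tendsto (f := fun n =>
    x - (Matrix.toEuclideanLin (A + B * K) ^ n) (y n)) (b := atTop) ?_ (Eventually.of_forall ?_)
  · simpa using hlim.const_sub x
  · intro n
    have := pow_sub_feedback_pow_mem_range_reachMap A B K n (y n)
    rwa [hy] at this

end Reachability

/-! ### The data on which the control design rests -/

/-- Seminorms measuring the unit-circle part and the stable part of the state, together with
linear inputs that generate the unit-circle part `proj x` in `d` steps. -/
structure ControlSplitting {d m : ℕ} (A : Matrix (Fin d) (Fin d) ℝ)
    (B : Matrix (Fin d) (Fin m) ℝ) where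
  proj : Module.End ℝ (RVec d)
  circle : Seminorm ℝ (RVec d)
  stable : Seminorm ℝ (RVec d)
  input : Fin d → RVec d →ₗ[ℝ] RVec m
  bound : ℝ
  rate : ℝ
  bound_nonneg : 0 ≤ bound
  rate_nonneg : 0 ≤ rate
  rate_lt_one : rate < 1
  circle_map_le : ∀ x, circle (Matrix.toEuclideanLin A x) ≤ circle x
  stable_map_le : ∀ x, stable (Matrix.toEuclideanLin A x) ≤ rate * stable x
  circle_le : ∀ x, circle x ≤ bound * ‖x‖
  stable_le : ∀ x, stable x ≤ bound * ‖x‖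
  norm_le : ∀ x, ‖x‖ ≤ circle x + stable x
  circle_sub_proj : ∀ x, circle (x - proj x) = 0
  norm_input_le : ∀ i x, ‖input i x‖ ≤ bound * circle x
  reachMap_input : ∀ x, reachMap A B (fun i => input i x) = proj x
  unitCirclePartVanishes : ∀ x, circle x = 0 → UnitCirclePartVanishes A x

theorem exists_controlSplitting {d m : ℕ} {A : Matrix (Fin d) (Fin d) ℝ}
    {B : Matrix (Fin d) (Fin m) ℝ} (hA : MarginallyStable A) (hAB : Stabilizable A B) :
    Nonempty (ControlSplitting A B) := by
  obtain ⟨P, hPA, hPP, horbit, ⟨Cs, ρ, hCs, hρ, hρ1, hs⟩, hvan⟩ := hA.exists_projection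
  set T : Module.End ℝ (RVec d) := Matrix.toEuclideanLin A with hT
  -- Orbits are bounded pointwise; uniform boundedness yields one constant, so the supremum defining
  -- `circle` is dominated by the norm.
  obtain ⟨Cu, hCu⟩ : ∃ Cu, ∀ n : ℕ, ‖LinearMap.toContinuousLinearMap ((T ^ n) * P)‖ ≤ Cu := by
    refine banach_steinhaus fun x => ?_
    obtain ⟨C, hC⟩ := horbit x
    exact ⟨C, fun n => (hC n).1⟩
  obtain ⟨Nu, hNuT, hNuP, hNuC, hNu0⟩ := exists_contracted_seminorm T P hPA (C := Cu) (ρ := 1)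
    one_pos fun n x => by
      simpa using ((LinearMap.toContinuousLinearMap ((T ^ n) * P)).le_opNorm x).trans
        (mul_le_mul_of_nonneg_right (hCu n) (norm_nonneg x))
  obtain ⟨Ns, hNsT, hNsP, hNsC, hNs0⟩ := exists_contracted_seminorm T (1 - P)
    (fun x => by simp [hPA]) hρ hs
  have hrange : ∀ x, P x ∈ LinearMap.range (reachMap A B) := by
    intro x
    obtain ⟨C, hC⟩ := horbit x
    exact hAB.mem_range_reachMap ⟨C, fun n => (hC n).2⟩
  obtain ⟨g, hg⟩ := (reachMap A B).rangeRestrict.exists_rightInverse_of_surjective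
    (LinearMap.range_rangeRestrict _)
  let G : RVec d →ₗ[ℝ] (Fin d → RVec m) := g ∘ₗ P.codRestrict _ hrange
  have hG : ∀ x, reachMap A B (G x) = P x := by
    intro x
    have := congrArg Subtype.val (LinearMap.congr_fun hg (P.codRestrict _ hrange x))
    exact this
  -- Since `G` factors through `P`, inputs are controlled by `circle` rather than by the full norm.
  -- Saturating `circle` therefore bounds them.
  have hGP : ∀ x, G (P x) = G x := by
    intro x
    simp only [G, LinearMap.comp_apply]
    congr 1
    exact Subtype.ext (hPP x)
  set CG := ‖LinearMap.toContinuousLinearMap G‖ with hCG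
  have hCu0 : 0 ≤ Cu := (norm_nonneg _).trans (hCu 0)
  refine ⟨⟨P, Nu, Ns, fun i => LinearMap.proj i ∘ₗ G, Cu + Cs + CG, ρ,
    by positivity, hρ.le, hρ1, fun x => by simpa using hNuT x, hNsT, fun x => ?_, fun x => ?_,
    fun x => ?_, fun x => hNu0 _ (by rw [map_sub, hPP, sub_self]), fun i x => ?_, fun x => ?_,
    fun x hx => ?_⟩⟩
  · refine (hNuC x).trans (mul_le_mul_of_nonneg_right ?_ (norm_nonneg x))
    linarith [norm_nonneg (LinearMap.toContinuousLinearMap G)]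
  · refine (hNsC x).trans (mul_le_mul_of_nonneg_right ?_ (norm_nonneg x))
    linarith [norm_nonneg (LinearMap.toContinuousLinearMap G)]
  · have h1 : ‖x - P x‖ ≤ Ns x := hNsP x
    calc ‖x‖ = ‖P x + (x - P x)‖ := by rw [add_sub_cancel]
      _ ≤ _ := norm_add_le_of_le (hNuP x) h1
  · calc ‖G x i‖ ≤ ‖G (P x)‖ := by rw [hGP]; exact norm_le_pi_norm (G x) i
      _ ≤ CG * ‖P x‖ := (LinearMap.toContinuousLinearMap G).le_opNorm _
      _ ≤ CG * Nu x := mul_le_mul_of_nonneg_left (hNuP x) (norm_nonneg _)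
      _ ≤ _ := mul_le_mul_of_nonneg_right (by linarith) (apply_nonneg _ _)
  · exact hG x
  · refine hvan x (norm_le_zero_iff.1 ?_)
    rw [← hx]
    exact hNuP x

/-! ### Cubic tails for processes with negative drift -/

section Drift

/-- The cubic tail `min 1 (K / v) ^ 3`, equal to `1` for `v ≤ K`. -/
noncomputable def cubicTail (K v : ℝ) : ℝ := if v ≤ K then 1 else (K / v) ^ 3

theorem cubicTail_le_one {K v : ℝ} (hK : 0 < K) : cubicTail K v ≤ 1 := by
  unfold cubicTail
  split_ifs with h
  · exact le_rfl
  · push Not at h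
    exact pow_le_one₀ (div_nonneg hK.le (hK.trans h).le) ((div_le_one (hK.trans h)).2 h.le)

theorem cubicTail_le_div_pow {K v : ℝ} (hv : 0 < v) : cubicTail K v ≤ (K / v) ^ 3 := by
  unfold cubicTail
  split_ifs with h
  · exact one_le_pow₀ ((one_le_div hv).2 h)
  · exact le_rfl

/-- A one-sided quadratic bound for `(1 - x)⁻³`: the difference of the two sides is `x ^ 2 * (26 -
88 x + 93 x ^ 2 - 32 x ^ 3)`. -/
theorem one_le_sub_pow_three_mul {x : ℝ} (hx : x ≤ 1 / 2) :
    1 ≤ (1 - x) ^ 3 * (1 + 3 * x + 32 * x ^ 2) := by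
  have h : 0 ≤ 26 - 88 * x + 93 * x ^ 2 - 32 * x ^ 3 := by
    nlinarith [sq_nonneg x, mul_nonneg (sq_nonneg x) (sub_nonneg.2 hx), sq_nonneg (x - 1 / 2)]
  nlinarith [mul_nonneg (sq_nonneg x) h]

/-- Jumps up to `u / 2` are handled by expansion. For larger jumps the trivial bound `1` is absorbed
by the quartic term, and this is where fourth moments enter. -/
theorem cubicTail_sub_le {K u s : ℝ} (hK : 0 < K) (hu : K ≤ u) :
    cubicTail K (u - s) ≤
      (K / u) ^ 3 * (1 + 3 * (s / u) + 32 * (s / u) ^ 2) + 16 * (s / u) ^ 4 := by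
  have hu0 : 0 < u := hK.trans_le hu
  set x := s / u with hx
  have hs : s = u * x := by rw [hx]; field_simp
  have hq : 0 ≤ 1 + 3 * x + 32 * x ^ 2 := by nlinarith [sq_nonneg (x + 3 / 64)]
  rcases le_or_gt x (1 / 2) with h | h
  · have h1 : 0 < 1 - x := by linarith
    have hv : u - s = u * (1 - x) := by rw [hs]; ring
    have h2 : cubicTail K (u - s) ≤ (K / u) ^ 3 * (1 + 3 * x + 32 * x ^ 2) := by
      refine (cubicTail_le_div_pow (by rw [hv]; positivity)).trans ?_
      rw [hv, ← div_div, div_pow, div_le_iff₀ (by positivity), mul_assoc]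
      refine le_mul_of_one_le_right (by positivity) ?_
      rw [mul_comm]
      exact one_le_sub_pow_three_mul h
    have : 0 ≤ 16 * x ^ 4 := by positivity
    linarith
  · have h1 : 1 ≤ 16 * x ^ 4 := by
      have : (1 / 2 : ℝ) ^ 4 ≤ x ^ 4 := pow_le_pow_left₀ (by norm_num) h.le 4
      linarith
    have : 0 ≤ (K / u) ^ 3 * (1 + 3 * x + 32 * x ^ 2) := mul_nonneg (by positivity) hq
    linarith [cubicTail_le_one (v := u - s) hK]

variable {Ω : Type*} [MeasurableSpace Ω] {μ : Measure Ω} [IsProbabilityMeasure μ]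

theorem measure_le_add_eq_lintegral {X s : Ω → ℝ} (hX : Measurable X) (hs : Measurable s)
    (h : IndepFun s X μ) (u : ℝ) :
    μ {ω | u ≤ X ω + s ω} = ∫⁻ ω, μ {ω' | u - s ω ≤ X ω'} ∂μ := by
  have hmap := (indepFun_iff_map_prod_eq_prod_map_map hs.aemeasurable hX.aemeasurable).1 h
  have hset : MeasurableSet {p : ℝ × ℝ | u ≤ p.2 + p.1} :=
    measurableSet_le measurable_const (measurable_snd.add measurable_fst)
  have h1 : μ {ω | u ≤ X ω + s ω} = μ.map (fun ω => (s ω, X ω)) {p : ℝ × ℝ | u ≤ p.2 + p.1} := by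
    rw [Measure.map_apply (hs.prodMk hX) hset]
    rfl
  rw [h1, hmap, Measure.prod_apply hset, lintegral_map (measurable_measure_prodMk_left hset) hs]
  refine lintegral_congr fun ω => ?_
  rw [Measure.map_apply hX (measurable_prodMk_left hset)]
  congr 1
  ext η
  simp

/-- A process which, above the level `K`, has independent increments with negative mean and
bounded fourth moments has a cubic tail, uniformly in time. -/
theorem measure_le_cubicTail_of_drift {X s : ℕ → Ω → ℝ} {K b₂ b₄ : ℝ}
    (hX : ∀ n, Measurable (X n)) (hs : ∀ n, Measurable (s n)) (hind : ∀ n, IndepFun (s n) (X n) μ)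
    (h4 : ∀ n, MemLp (s n) 4 μ) (hmean : ∀ n, ∫ ω, s n ω ∂μ ≤ -1)
    (hb₂ : ∀ n, ∫ ω, s n ω ^ 2 ∂μ ≤ b₂) (hb₄ : ∀ n, ∫ ω, s n ω ^ 4 ∂μ ≤ b₄)
    (hK : 1 ≤ K) (hKb₂ : 32 * b₂ ≤ K) (hKb₄ : 8 * b₄ ≤ K)
    (h0 : ∀ ω, X 0 ω ≤ K) (hrec : ∀ n ω, X (n + 1) ω ≤ max (X n ω + s n ω) K) (n : ℕ) (v : ℝ) :
    μ {ω | v ≤ X n ω} ≤ ENNReal.ofReal (cubicTail K v) := by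
  have hone : ∀ (n : ℕ) (v : ℝ), v ≤ K → μ {ω | v ≤ X n ω} ≤ ENNReal.ofReal (cubicTail K v) := by
    intro n v hv
    rw [cubicTail, if_pos hv, ENNReal.ofReal_one]
    exact prob_le_one
  induction n generalizing v with
  | zero =>
    rcases le_or_gt v K with hv | hv
    · exact hone 0 v hv
    · have : {ω | v ≤ X 0 ω} = ∅ := by
        ext ω
        simpa using (h0 ω).trans_lt hv
      simp [this]
  | succ n ih =>
    rcases le_or_gt v K with hv | hv
    · exact hone _ v hv
    have hK0 : 0 < K := by linarith
    have hv0 : 0 < v := hK0.trans hv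
    have i1 : Integrable (s n) μ := (h4 n).integrable (by norm_num)
    have i2 : Integrable (fun ω => s n ω ^ 2) μ := ((h4 n).mono_exponent (by norm_num)).integrable_sq
    have i4 : Integrable (fun ω => s n ω ^ 4) μ := by
      have := (h4 n).integrable_norm_pow (p := 4) (by norm_num)
      refine this.congr (Eventually.of_forall fun ω => ?_)
      simp only [Real.norm_eq_abs]
      exact Even.pow_abs (by decide) _
    set q : Ω → ℝ := fun ω => (K / v) ^ 3 * (1 + 3 * (s n ω / v) + 32 * (s n ω / v) ^ 2)
      + 16 * (s n ω / v) ^ 4 with hq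
    have hq0 : ∀ ω, 0 ≤ q ω := by
      intro ω
      have : 0 ≤ 1 + 3 * (s n ω / v) + 32 * (s n ω / v) ^ 2 := by
        nlinarith [sq_nonneg (s n ω / v + 3 / 64)]
      positivity
    have hq_eq : q = fun ω => (K / v) ^ 3 + (K / v) ^ 3 * 3 / v * s n ω
        + (K / v) ^ 3 * 32 / v ^ 2 * s n ω ^ 2 + 16 / v ^ 4 * s n ω ^ 4 := by
      ext ω
      simp only [hq]
      field_simp
    have j1 : Integrable (fun ω => (K / v) ^ 3 + (K / v) ^ 3 * 3 / v * s n ω) μ :=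
      (integrable_const _).add (i1.const_mul _)
    have j2 : Integrable (fun ω => (K / v) ^ 3 + (K / v) ^ 3 * 3 / v * s n ω
        + (K / v) ^ 3 * 32 / v ^ 2 * s n ω ^ 2) μ := j1.add (i2.const_mul _)
    have hqi : Integrable q μ := by
      rw [hq_eq]
      exact j2.add (i4.const_mul _)
    -- In units of `(K / v) ^ 3 / v` the linear, quadratic and quartic terms contribute at most
    -- `-3`, `1` and `2`, so the drift pays for both errors.
    have hqint : ∫ ω, q ω ∂μ ≤ (K / v) ^ 3 := by
      have : ∫ ω, q ω ∂μ = (K / v) ^ 3 + (K / v) ^ 3 * 3 / v * ∫ ω, s n ω ∂μ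
          + (K / v) ^ 3 * 32 / v ^ 2 * ∫ ω, s n ω ^ 2 ∂μ + 16 / v ^ 4 * ∫ ω, s n ω ^ 4 ∂μ := by
        rw [hq_eq, integral_add j2 (i4.const_mul _), integral_add j1 (i2.const_mul _),
          integral_add (integrable_const _) (i1.const_mul _)]
        simp [integral_const_mul]
      rw [this]
      have e1 : (K / v) ^ 3 * 3 / v * ∫ ω, s n ω ∂μ ≤ (K / v) ^ 3 * 3 / v * (-1) :=
        mul_le_mul_of_nonneg_left (hmean n) (by positivity)
      have e2 : (K / v) ^ 3 * 32 / v ^ 2 * ∫ ω, s n ω ^ 2 ∂μ ≤ (K / v) ^ 3 / v := by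
        calc _ ≤ (K / v) ^ 3 * 32 / v ^ 2 * (v / 32) := by
              refine mul_le_mul_of_nonneg_left ?_ (by positivity)
              linarith [hb₂ n]
          _ = _ := by field_simp
      have e4 : 16 / v ^ 4 * ∫ ω, s n ω ^ 4 ∂μ ≤ 2 * ((K / v) ^ 3 / v) := by
        have hK3 : K ≤ K ^ 3 := le_self_pow₀ hK (by norm_num)
        calc _ ≤ 16 / v ^ 4 * (K ^ 3 / 8) := by
              refine mul_le_mul_of_nonneg_left ?_ (by positivity)
              linarith [hb₄ n]
          _ = _ := by field_simp; norm_num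
      have e5 : (K / v) ^ 3 * 3 / v * (-1) = -(3 * ((K / v) ^ 3 / v)) := by ring
      linarith
    calc μ {ω | v ≤ X (n + 1) ω} ≤ μ {ω | v ≤ X n ω + s n ω} := by
          refine measure_mono fun ω hω => ?_
          have hω : v ≤ X (n + 1) ω := hω
          rcases le_max_iff.1 (hω.trans (hrec n ω)) with h | h
          · exact h
          · exact absurd hv (not_lt.2 h)
      _ = ∫⁻ ω, μ {ω' | v - s n ω ≤ X n ω'} ∂μ := measure_le_add_eq_lintegral (hX n) (hs n) (hind n) v
      -- The induction hypothesis is used at the random level `v - s n ω`, hence its quantification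
      -- over all levels.
      _ ≤ ∫⁻ ω, ENNReal.ofReal (q ω) ∂μ := lintegral_mono fun ω =>
          (ih _).trans (ENNReal.ofReal_le_ofReal (cubicTail_sub_le hK0 hv.le))
      _ = ENNReal.ofReal (∫ ω, q ω ∂μ) :=
          (ofReal_integral_eq_lintegral_ofReal hqi (Eventually.of_forall hq0)).symm
      _ ≤ ENNReal.ofReal (cubicTail K v) := by
          rw [cubicTail, if_neg (not_le.2 hv)]
          exact ENNReal.ofReal_le_ofReal hqint

/-- A cubic tail bounds the second moment. -/
theorem lintegral_sq_le_of_cubicTail {X : Ω → ℝ} {K : ℝ} (hX : Measurable X) (hX0 : ∀ ω, 0 ≤ X ω)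
    (hK : 0 < K) (h : ∀ v, μ {ω | v ≤ X ω} ≤ ENNReal.ofReal (cubicTail K v)) :
    ∫⁻ ω, ENNReal.ofReal (X ω ^ 2) ∂μ ≤ ENNReal.ofReal (9 * K ^ 2) := by
  -- Dyadic shells: on `2 ^ j K ≤ X < 2 ^ (j + 1) K` the square is at most `c j`, while the tail is
  -- at most `8⁻ʲ`. The series sums to `8 K ^ 2`, and `X ≤ K` adds `K ^ 2`.
  set c : ℕ → ℝ := fun j => 4 * K ^ 2 * 4 ^ j with hc
  set S : ℕ → Set Ω := fun j => {ω | 2 ^ j * K ≤ X ω} with hS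
  have hSm : ∀ j, MeasurableSet (S j) := fun j => measurableSet_le measurable_const hX
  have hpt : ∀ ω, ENNReal.ofReal (X ω ^ 2) ≤ ENNReal.ofReal (K ^ 2) +
      ∑' j, (S j).indicator (fun _ => ENNReal.ofReal (c j)) ω := by
    intro ω
    rcases le_or_gt (X ω) K with hle | hlt
    · exact le_add_right (ENNReal.ofReal_le_ofReal (pow_le_pow_left₀ (hX0 ω) hle 2))
    · obtain ⟨j, hj1, hj2⟩ := exists_nat_pow_near ((one_le_div hK).2 hlt.le) (one_lt_two)
      rw [le_div_iff₀ hK] at hj1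
      rw [div_lt_iff₀ hK] at hj2
      refine le_add_left (le_trans ?_ (ENNReal.le_tsum j))
      rw [Set.indicator_of_mem (show ω ∈ S j from hj1)]
      refine ENNReal.ofReal_le_ofReal ?_
      calc X ω ^ 2 ≤ (2 ^ (j + 1) * K) ^ 2 := pow_le_pow_left₀ (hX0 ω) hj2.le 2
        _ = c j := by
          simp only [hc]
          rw [show (4 : ℝ) = 2 ^ 2 by norm_num, ← pow_mul]
          ring
  have hterm : ∀ j, ENNReal.ofReal (c j) * μ (S j) ≤ ENNReal.ofReal (4 * K ^ 2 * (1 / 2) ^ j) := by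
    intro j
    have h1 : cubicTail K (2 ^ j * K) ≤ (1 / 8) ^ j := by
      refine (cubicTail_le_div_pow (by positivity)).trans (le_of_eq ?_)
      rw [mul_comm, ← div_div, div_self hK.ne', show (1 / 8 : ℝ) = (1 / 2) ^ 3 by norm_num,
        ← pow_mul, mul_comm 3 j, pow_mul, one_div_pow, one_div_pow, one_div_pow]
    calc _ ≤ ENNReal.ofReal (c j) * ENNReal.ofReal ((1 / 8) ^ j) := by
          gcongr
          exact (h _).trans (ENNReal.ofReal_le_ofReal h1)
      _ = _ := by
          rw [← ENNReal.ofReal_mul (by positivity)]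
          congr 1
          simp only [hc]
          rw [mul_assoc, ← mul_pow]
          norm_num
  calc _ ≤ ∫⁻ ω, (ENNReal.ofReal (K ^ 2) +
        ∑' j, (S j).indicator (fun _ => ENNReal.ofReal (c j)) ω) ∂μ := lintegral_mono hpt
    _ = ENNReal.ofReal (K ^ 2) + ∑' j, ENNReal.ofReal (c j) * μ (S j) := by
        rw [lintegral_add_left measurable_const, lintegral_tsum fun j =>
          (measurable_const.indicator (hSm j)).aemeasurable]
        simp [lintegral_indicator_const (hSm _)]
    _ ≤ ENNReal.ofReal (K ^ 2) + ∑' j, ENNReal.ofReal (4 * K ^ 2 * (1 / 2) ^ j) := by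
        gcongr with j
        exact hterm j
    _ = ENNReal.ofReal (K ^ 2) + ENNReal.ofReal (8 * K ^ 2) := by
        rw [← ENNReal.ofReal_tsum_of_nonneg (fun j => by positivity)
          (summable_geometric_two.mul_left _), tsum_mul_left, tsum_geometric_two]
        congr 2
        ring
    _ = _ := by
        rw [← ENNReal.ofReal_add (by positivity) (by positivity)]
        congr 1
        ring

end Drift

/-! ### Closed loop under saturated feedback -/

/-- Variation of constants. -/
theorem eq_pow_apply_add_sum {E : Type*} [AddCommGroup E] [Module ℝ E] (T : Module.End ℝ E)
    {y q : ℕ → E} (h : ∀ i, y (i + 1) = T (y i) + q i) (j : ℕ) :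
    y j = (T ^ j) (y 0) + ∑ i ∈ Finset.range j, (T ^ (j - 1 - i)) (q i) := by
  induction j with
  | zero => simp
  | succ j ih =>
    rw [h, ih, map_add, map_sum, ← Module.End.mul_apply, ← pow_succ', Finset.sum_range_succ,
      add_assoc]
    congr 2
    · refine Finset.sum_congr rfl fun i hi => ?_
      have := Finset.mem_range.1 hi
      rw [← Module.End.mul_apply, ← pow_succ']
      congr 2
      omega
    · simp

namespace ControlSplitting

variable {d m : ℕ} {A : Matrix (Fin d) (Fin d) ℝ} {B : Matrix (Fin d) (Fin m) ℝ}
  (S : ControlSplitting A B)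

theorem continuous_circle : Continuous S.circle :=
  Seminorm.continuous_of_le (q := (Real.toNNReal S.bound) • normSeminorm ℝ (RVec d))
    (continuous_const.mul continuous_norm) fun x => by
      change S.circle x ≤ (Real.toNNReal S.bound : ℝ) * ‖x‖
      rw [Real.coe_toNNReal _ S.bound_nonneg]
      exact S.circle_le x

theorem continuous_stable : Continuous S.stable :=
  Seminorm.continuous_of_le (q := (Real.toNNReal S.bound) • normSeminorm ℝ (RVec d))
    (continuous_const.mul continuous_norm) fun x => by
      change S.stable x ≤ (Real.toNNReal S.bound : ℝ) * ‖x‖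
      rw [Real.coe_toNNReal _ S.bound_nonneg]
      exact S.stable_le x

theorem circle_pow_le (n : ℕ) (x : RVec d) :
    S.circle ((Matrix.toEuclideanLin A ^ n) x) ≤ S.circle x := by
  induction n with
  | zero => simp
  | succ n ih =>
    rw [pow_succ', Module.End.mul_apply]
    exact (S.circle_map_le _).trans ih

/-- A constant bounding the effect of an input on both seminorms. -/
noncomputable def inputBound : ℝ :=
  S.bound * ‖LinearMap.toContinuousLinearMap (Matrix.toEuclideanLin B)‖

theorem inputBound_nonneg : 0 ≤ S.inputBound := mul_nonneg S.bound_nonneg (norm_nonneg _)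

theorem circle_input_le (u : RVec m) :
    S.circle (Matrix.toEuclideanLin B u) ≤ S.inputBound * ‖u‖ := by
  refine (S.circle_le _).trans ?_
  rw [inputBound, mul_assoc]
  exact mul_le_mul_of_nonneg_left
    ((LinearMap.toContinuousLinearMap (Matrix.toEuclideanLin B)).le_opNorm u) S.bound_nonneg

theorem stable_input_le (u : RVec m) :
    S.stable (Matrix.toEuclideanLin B u) ≤ S.inputBound * ‖u‖ := by
  refine (S.stable_le _).trans ?_
  rw [inputBound, mul_assoc]
  exact mul_le_mul_of_nonneg_left
    ((LinearMap.toContinuousLinearMap (Matrix.toEuclideanLin B)).le_opNorm u) S.bound_nonneg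

/-- The saturation factor of level `r`. -/
noncomputable def gain (r : ℝ) (y : RVec d) : ℝ := r / max r (S.circle y)

variable {r : ℝ}

theorem gain_nonneg (hr : 0 < r) (y : RVec d) : 0 ≤ S.gain r y :=
  div_nonneg hr.le (hr.le.trans (le_max_left _ _))

theorem gain_le_one (hr : 0 < r) (y : RVec d) : S.gain r y ≤ 1 :=
  (div_le_one (hr.trans_le (le_max_left _ _))).2 (le_max_left _ _)

theorem gain_mul_circle_le (hr : 0 < r) (y : RVec d) : S.gain r y * S.circle y ≤ r := by
  rw [gain, div_mul_eq_mul_div, div_le_iff₀ (hr.trans_le (le_max_left _ _))]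
  exact mul_le_mul_of_nonneg_left (le_max_right _ _) hr.le

/-- Scaling by `1 - gain` is soft thresholding of `circle` at level `r`. -/
theorem one_sub_gain_mul_circle (hr : 0 < r) (y : RVec d) :
    (1 - S.gain r y) * S.circle y = max (S.circle y - r) 0 := by
  rcases le_total (S.circle y) r with h | h
  · rw [gain, max_eq_left h, div_self hr.ne', max_eq_right (by linarith)]
    ring
  · have : 0 < S.circle y := hr.trans_le h
    rw [gain, max_eq_right h, max_eq_left (by linarith)]
    field_simp

/-- Saturated feedback: the `i`-th input of a segment as a function of the first state of the
segment. -/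
noncomputable def feedback (r : ℝ) (i : Fin d) (x : RVec d) : RVec m :=
  -(S.gain r ((Matrix.toEuclideanLin A ^ d) x) • S.input i ((Matrix.toEuclideanLin A ^ d) x))

theorem norm_feedback_le (hr : 0 < r) (i : Fin d) (x : RVec d) :
    ‖S.feedback r i x‖ ≤ S.bound * r := by
  set y := (Matrix.toEuclideanLin A ^ d) x with hy
  rw [feedback, norm_neg, norm_smul, Real.norm_of_nonneg (S.gain_nonneg hr _)]
  calc _ ≤ S.gain r y * (S.bound * S.circle y) :=
        mul_le_mul_of_nonneg_left (S.norm_input_le i _) (S.gain_nonneg hr _)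
    _ = S.bound * (S.gain r y * S.circle y) := by ring
    _ ≤ _ := mul_le_mul_of_nonneg_left (S.gain_mul_circle_le hr y) S.bound_nonneg

theorem norm_feedback_le_circle (hr : 0 < r) (i : Fin d) (x : RVec d) :
    ‖S.feedback r i x‖ ≤ S.bound * S.circle x := by
  rw [feedback, norm_neg, norm_smul, Real.norm_of_nonneg (S.gain_nonneg hr _)]
  calc _ ≤ 1 * ‖S.input i ((Matrix.toEuclideanLin A ^ d) x)‖ :=
        mul_le_mul_of_nonneg_right (S.gain_le_one hr _) (norm_nonneg _)
    _ ≤ S.bound * S.circle ((Matrix.toEuclideanLin A ^ d) x) := by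
        rw [one_mul]
        exact S.norm_input_le i _
    _ ≤ _ := mul_le_mul_of_nonneg_left (S.circle_pow_le d x) S.bound_nonneg

theorem continuous_feedback (hr : 0 < r) (i : Fin d) : Continuous (S.feedback r i) := by
  have hT : Continuous fun x => (Matrix.toEuclideanLin A ^ d) x :=
    LinearMap.continuous_of_finiteDimensional (Matrix.toEuclideanLin A ^ d)
  have hg : Continuous (S.gain r) :=
    continuous_const.div (continuous_const.max S.continuous_circle)
      fun y => (hr.trans_le (le_max_left _ _)).ne'
  exact ((hg.comp hT).smul
    ((LinearMap.continuous_of_finiteDimensional (S.input i)).comp hT)).neg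

/-- The gain depends only on the first state of the segment, so it factors out of the linear
reachability map. -/
theorem reachMap_feedback (x : RVec d) :
    reachMap A B (fun i => S.feedback r i x) =
      -(S.gain r ((Matrix.toEuclideanLin A ^ d) x) • S.proj ((Matrix.toEuclideanLin A ^ d) x)) := by
  rw [← S.reachMap_input, ← map_smul, ← map_neg]
  rfl

/-- The saturated feedback, applied to the first state of each segment of length `d`. -/
noncomputable def policy (hd : 0 < d) (hr : 0 < r) : HistoryPolicy d m d where
  act t h := S.feedback r ⟨t % d, Nat.mod_lt t hd⟩ (h ⟨t % d, Nat.mod_lt t hd⟩)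
  measurable_act _ := (S.continuous_feedback hr _).measurable.comp (measurable_pi_apply _)

theorem isConcatenation_policy (hd : 0 < d) (hr : 0 < r) : (S.policy hd hr).IsConcatenation := by
  refine ⟨S.feedback r, fun t i hi h => ?_⟩
  have : i = ⟨t % d, Nat.mod_lt t hd⟩ := Fin.ext hi
  rw [this]
  rfl

variable (hd : 0 < d) (hr : 0 < r) (v : ℕ → RVec d) (x : RVec d)

/-- The trajectory under the saturated feedback. -/
noncomputable def traj : ℕ → RVec d := closedLoop A B (S.policy hd hr) v x

theorem traj_zero : S.traj hd hr v x 0 = x := closedLoop_zero A B _ v x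

theorem traj_succ (t : ℕ) : S.traj hd hr v x (t + 1) =
    Matrix.toEuclideanLin A (S.traj hd hr v x t) + Matrix.toEuclideanLin B
      (S.feedback r ⟨t % d, Nat.mod_lt t hd⟩ (S.traj hd hr v x (d * (t / d)))) + v t := by
  have h : t - t % d = d * (t / d) := by
    have := Nat.mod_add_div t d
    omega
  rw [traj, closedLoop_succ]
  simp only [policy, h]

/-- The recursion behind both conclusions. Over a segment the inputs soft-threshold the circle part
of `A ^ d y`, and propagation by `A` does not enlarge the noise. -/
theorem circle_traj_segment_le (n : ℕ) :
    S.circle (S.traj hd hr v x (d * (n + 1))) ≤ max (S.circle (S.traj hd hr v x (d * n)) - r) 0 +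
      ∑ i ∈ Finset.range d, S.circle (v (d * n + i)) := by
  set y := S.traj hd hr v x (d * n) with hy
  set T : Module.End ℝ (RVec d) := Matrix.toEuclideanLin A with hT
  have hseg : S.traj hd hr v x (d * (n + 1)) = (T ^ d) y -
      S.gain r ((T ^ d) y) • S.proj ((T ^ d) y) +
      ∑ i ∈ Finset.range d, (T ^ (d - 1 - i)) (v (d * n + i)) := by
    have h := eq_pow_apply_add_sum T (y := fun i => S.traj hd hr v x (d * n + i))
      (fun i => by
        have := S.traj_succ hd hr v x (d * n + i)
        rw [add_assoc (T _)] at this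
        exact this) d
    rw [mul_add_one, h, sub_eq_add_neg, ← S.reachMap_feedback, reachMap_apply, add_assoc]
    congr 1
    simp_rw [map_add]
    rw [Finset.sum_add_distrib]
    congr 1
    rw [Finset.sum_range]
    refine Finset.sum_congr rfl fun i _ => ?_
    have h1 : (d * n + (i : ℕ)) % d = i := by
      rw [Nat.mul_add_mod, Nat.mod_eq_of_lt i.2]
    have h2 : (d * n + (i : ℕ)) / d = n := by
      rw [Nat.mul_add_div hd, Nat.div_eq_of_lt i.2, add_zero]
    simp only [h1, h2]
    rfl
  rw [hseg]
  refine (map_add_le_add S.circle _ _).trans (add_le_add ?_ ?_)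
  · set z := (T ^ d) y with hz
    -- The second summand is invisible to `circle`; the first is a pure rescaling.
    have hsplit : z - S.gain r z • S.proj z =
        (1 - S.gain r z) • z + S.gain r z • (z - S.proj z) := by
      rw [sub_smul, one_smul, smul_sub]
      abel
    rw [hsplit]
    refine (map_add_le_add S.circle _ _).trans ?_
    rw [map_smul_eq_mul, map_smul_eq_mul, S.circle_sub_proj, mul_zero, add_zero,
      Real.norm_of_nonneg (sub_nonneg.2 (S.gain_le_one hr z)), S.one_sub_gain_mul_circle hr]
    exact max_le_max (sub_le_sub_right (S.circle_pow_le d y) r) le_rfl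
  · refine (Finset.le_sum_of_subadditive S.circle (map_zero S.circle).le
      (map_add_le_add S.circle) _ _).trans ?_
    exact Finset.sum_le_sum fun i _ => S.circle_pow_le _ _

theorem circle_traj_succ_le (t : ℕ) : S.circle (S.traj hd hr v x (t + 1)) ≤
    S.circle (S.traj hd hr v x t) + S.inputBound *
      ‖S.feedback r ⟨t % d, Nat.mod_lt t hd⟩ (S.traj hd hr v x (d * (t / d)))‖
      + S.circle (v t) := by
  rw [traj_succ]
  exact (map_add_le_add S.circle _ _).trans (add_le_add_left ((map_add_le_add S.circle _ _).trans
    (add_le_add (S.circle_map_le _) (S.circle_input_le _))) _)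

theorem stable_traj_succ_le (t : ℕ) : S.stable (S.traj hd hr v x (t + 1)) ≤
    S.rate * S.stable (S.traj hd hr v x t) + S.inputBound *
      ‖S.feedback r ⟨t % d, Nat.mod_lt t hd⟩ (S.traj hd hr v x (d * (t / d)))‖
      + S.stable (v t) := by
  rw [traj_succ]
  exact (map_add_le_add S.stable _ _).trans (add_le_add_left ((map_add_le_add S.stable _ _).trans
    (add_le_add (S.stable_map_le _) (S.stable_input_le _))) _)

/-! ### Asymptotic stability without noise -/

section NoiseFree

theorem circle_traj_noiseFree_segment_le (n : ℕ) :
    S.circle (S.traj hd hr 0 x (d * n)) ≤ max (S.circle x - n * r) 0 := by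
  induction n with
  | zero => simp [traj_zero]
  | succ n ih =>
    refine (S.circle_traj_segment_le hd hr 0 x n).trans ?_
    simp only [Pi.zero_apply, map_zero, Finset.sum_const_zero, add_zero]
    refine max_le ?_ (le_max_right _ _)
    rcases le_max_iff.1 ih with h | h
    · refine le_max_of_le_left ?_
      push_cast
      linarith
    · exact le_max_of_le_right (by linarith)

/-- At most `d` inputs act inside a segment, each bounded linearly by `circle` at its start. In
particular, `circle` remains zero once a segment starts with zero. -/
theorem circle_traj_noiseFree_le_start (t : ℕ) : S.circle (S.traj hd hr 0 x t) ≤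
    (1 + d * (S.inputBound * S.bound)) * S.circle (S.traj hd hr 0 x (d * (t / d))) := by
  set n := t / d with hn
  set c := S.circle (S.traj hd hr 0 x (d * n)) with hc
  have hc0 : 0 ≤ c := apply_nonneg _ _
  have hk : 0 ≤ S.inputBound * S.bound := mul_nonneg S.inputBound_nonneg S.bound_nonneg
  have h : ∀ j ≤ d, S.circle (S.traj hd hr 0 x (d * n + j)) ≤
      (1 + j * (S.inputBound * S.bound)) * c := by
    intro j
    induction j with
    | zero => intro _; simp [hc]
    | succ j ih =>
      intro hj
      have h2 : (d * n + j) / d = n := by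
        rw [Nat.mul_add_div hd, Nat.div_eq_of_lt hj, add_zero]
      have h3 := S.circle_traj_succ_le hd hr 0 x (d * n + j)
      rw [h2] at h3
      have h4 : S.inputBound * ‖S.feedback r ⟨(d * n + j) % d, Nat.mod_lt _ hd⟩
          (S.traj hd hr 0 x (d * n))‖ ≤ S.inputBound * (S.bound * c) :=
        mul_le_mul_of_nonneg_left (S.norm_feedback_le_circle hr _ _) S.inputBound_nonneg
      have h5 := ih (by omega)
      simp only [Pi.zero_apply, map_zero, add_zero] at h3
      rw [← add_assoc]
      push_cast
      linarith
  have hlt := Nat.mod_lt t hd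
  have := h (t % d) hlt.le
  rw [hn, Nat.div_add_mod] at this
  refine this.trans (mul_le_mul_of_nonneg_right ?_ hc0)
  have : ((t % d : ℕ) : ℝ) ≤ d := by exact_mod_cast hlt.le
  nlinarith

theorem stable_traj_noiseFree_le {t : ℕ} {e : ℝ}
    (h : S.circle (S.traj hd hr 0 x (d * (t / d))) ≤ e) :
    S.stable (S.traj hd hr 0 x (t + 1)) ≤
      S.rate * S.stable (S.traj hd hr 0 x t) + S.inputBound * S.bound * e := by
  have h1 := S.stable_traj_succ_le hd hr 0 x t
  have h2 : S.inputBound * ‖S.feedback r ⟨t % d, Nat.mod_lt t hd⟩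
      (S.traj hd hr 0 x (d * (t / d)))‖ ≤ S.inputBound * (S.bound * e) :=
    mul_le_mul_of_nonneg_left ((S.norm_feedback_le_circle hr _ _).trans
      (mul_le_mul_of_nonneg_left h S.bound_nonneg)) S.inputBound_nonneg
  simp only [Pi.zero_apply, map_zero, add_zero] at h1
  linarith

theorem exists_circle_traj_noiseFree_start_eq_zero :
    ∃ N : ℕ, ∀ n, N ≤ n → S.circle (S.traj hd hr 0 x (d * n)) = 0 := by
  obtain ⟨N, hN⟩ := exists_nat_ge (S.circle x / r)
  refine ⟨N, fun n hn => le_antisymm ?_ (apply_nonneg _ _)⟩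
  refine (S.circle_traj_noiseFree_segment_le hd hr x n).trans (max_le ?_ le_rfl)
  rw [div_le_iff₀ hr] at hN
  have : (N : ℝ) * r ≤ n * r := mul_le_mul_of_nonneg_right (by exact_mod_cast hn) hr.le
  linarith

theorem exists_norm_traj_noiseFree_le :
    ∃ C : ℝ, 0 < C ∧ ∀ x t, ‖S.traj hd hr 0 x t‖ ≤ C * ‖x‖ := by
  set k := S.inputBound * S.bound with hkdef
  have hk : 0 ≤ k := mul_nonneg S.inputBound_nonneg S.bound_nonneg
  have hρ : 0 < 1 - S.rate := by linarith [S.rate_lt_one]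
  have hb := S.bound_nonneg
  -- The term `k * S.bound / (1 - S.rate)` is the geometric-series bound for the stable part driven
  -- by the inputs.
  refine ⟨(1 + d * k) * S.bound + (S.bound + k * S.bound / (1 - S.rate)) + 1, by positivity,
    fun x t => ?_⟩
  have hstart : ∀ n, S.circle (S.traj hd hr 0 x (d * n)) ≤ S.circle x := by
    intro n
    refine (S.circle_traj_noiseFree_segment_le hd hr x n).trans (max_le ?_ (apply_nonneg _ _))
    have : 0 ≤ (n : ℝ) * r := by positivity
    linarith
  have hx := S.circle_le x
  have h1 : S.circle (S.traj hd hr 0 x t) ≤ (1 + d * k) * (S.bound * ‖x‖) :=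
    (S.circle_traj_noiseFree_le_start hd hr x t).trans
      (mul_le_mul_of_nonneg_left ((hstart _).trans hx) (by positivity))
  have h2 : ∀ t, S.stable (S.traj hd hr 0 x t) ≤
      (S.bound + k * S.bound / (1 - S.rate)) * ‖x‖ := by
    intro t
    induction t with
    | zero =>
      rw [traj_zero]
      refine (S.stable_le x).trans (mul_le_mul_of_nonneg_right ?_ (norm_nonneg x))
      have : 0 ≤ k * S.bound / (1 - S.rate) := by positivity
      linarith
    | succ t ih =>
      refine (S.stable_traj_noiseFree_le hd hr x ((hstart _).trans hx)).trans ?_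
      have e1 := mul_le_mul_of_nonneg_left ih S.rate_nonneg
      have e2 : k * (S.bound * ‖x‖) = (1 - S.rate) * (k * S.bound / (1 - S.rate)) * ‖x‖ := by
        field_simp
      have e3 : 0 ≤ (1 - S.rate) * (S.bound * ‖x‖) := by positivity
      rw [← hkdef, e2]
      linarith
  have h3 := S.norm_le (S.traj hd hr 0 x t)
  have h4 := h2 t
  have h5 := norm_nonneg x
  linarith

theorem tendsto_traj_noiseFree : Tendsto (S.traj hd hr 0 x) atTop (𝓝 0) := by
  obtain ⟨N, hN⟩ := S.exists_circle_traj_noiseFree_start_eq_zero hd hr x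
  have hdiv : ∀ t, d * N ≤ t → S.circle (S.traj hd hr 0 x (d * (t / d))) = 0 := fun t ht =>
    hN _ ((Nat.le_div_iff_mul_le hd).2 (by linarith [mul_comm d N]))
  -- After segment `N` all inputs vanish, leaving a pure contraction.
  have hgeo : ∀ j, S.stable (S.traj hd hr 0 x (d * N + j)) ≤
      S.rate ^ j * S.stable (S.traj hd hr 0 x (d * N)) := by
    intro j
    induction j with
    | zero => simp
    | succ j ih =>
      refine (S.stable_traj_noiseFree_le hd hr x (hdiv _ (Nat.le_add_right _ _)).le).trans ?_
      rw [mul_zero, add_zero, pow_succ', mul_assoc]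
      exact mul_le_mul_of_nonneg_left ih S.rate_nonneg
  rw [← tendsto_add_atTop_iff_nat (d * N)]
  refine squeeze_zero_norm (a := fun j => S.rate ^ j * S.stable (S.traj hd hr 0 x (d * N)))
    (fun j => ?_) ?_
  · have h1 := S.circle_traj_noiseFree_le_start hd hr x (d * N + j)
    rw [hdiv _ (Nat.le_add_right _ _), mul_zero] at h1
    rw [add_comm j]
    linarith [S.norm_le (S.traj hd hr 0 x (d * N + j)), hgeo j]
  · simpa using (tendsto_pow_atTop_nhds_zero_of_lt_one S.rate_nonneg S.rate_lt_one).mul_const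
      (S.stable (S.traj hd hr 0 x (d * N)))

theorem originAsymptoticallyStable_traj :
    OriginAsymptoticallyStable fun x => S.traj hd hr 0 x := by
  obtain ⟨C, hC, h⟩ := S.exists_norm_traj_noiseFree_le hd hr
  refine ⟨fun ε hε => ⟨ε / C, by positivity, fun x hx t => (h x t).trans_lt ?_⟩,
    fun x => S.tendsto_traj_noiseFree hd hr x⟩
  rwa [lt_div_iff₀ hC, mul_comm] at hx

theorem exists_unitCirclePartVanishes_traj :
    ∃ N : ℕ, ∀ t, N ≤ t → UnitCirclePartVanishes A (S.traj hd hr 0 x t) := by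
  obtain ⟨N, hN⟩ := S.exists_circle_traj_noiseFree_start_eq_zero hd hr x
  refine ⟨d * N, fun t ht => S.unitCirclePartVanishes _ (le_antisymm ?_ (apply_nonneg _ _))⟩
  have h1 := S.circle_traj_noiseFree_le_start hd hr x t
  rwa [hN _ ((Nat.le_div_iff_mul_le hd).2 (by linarith [mul_comm d N])), mul_zero] at h1

end NoiseFree

end ControlSplitting

/-! ### Elementary moment inequalities -/

section Moments

variable {Ω : Type*} [MeasurableSpace Ω] {μ : Measure Ω}

theorem exists_fourth_moment_bound {E : Type*} [NormedAddCommGroup E] [MeasurableSpace E]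
    [BorelSpace E] [SecondCountableTopology E] {w : ℕ → Ω → E} (hw : ∀ t, Measurable (w t))
    (h : (⨆ t, ∫⁻ ω, ‖w t ω‖ₑ ^ 4 ∂μ) < ∞) :
    ∃ W : ℝ, 0 ≤ W ∧ ∀ t, MemLp (w t) 4 μ ∧ ∫ ω, ‖w t ω‖ ^ 4 ∂μ ≤ W := by
  refine ⟨(⨆ t, ∫⁻ ω, ‖w t ω‖ₑ ^ 4 ∂μ).toReal, ENNReal.toReal_nonneg, fun t => ⟨?_, ?_⟩⟩
  · refine ⟨(hw t).aestronglyMeasurable, ?_⟩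
    rw [eLpNorm_lt_top_iff_lintegral_rpow_enorm_lt_top (by norm_num) (by norm_num)]
    refine lt_of_le_of_lt (le_of_eq ?_) ((le_iSup _ t).trans_lt h)
    refine lintegral_congr fun ω => ?_
    rw [ENNReal.toReal_ofNat, ← ENNReal.rpow_natCast]
    norm_num
  · rw [integral_eq_lintegral_of_nonneg_ae (Eventually.of_forall fun ω => by positivity)
      ((hw t).norm.pow_const 4).aestronglyMeasurable]
    refine ENNReal.toReal_mono h.ne (le_trans (le_of_eq ?_) (le_iSup _ t))
    refine lintegral_congr fun ω => ?_
    rw [ENNReal.ofReal_pow (norm_nonneg _), ofReal_norm]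

theorem lintegral_sq_le_of_le_add {f g h : Ω → ℝ} (hg : Measurable g) (hf : ∀ ω, 0 ≤ f ω)
    (hle : ∀ ω, f ω ≤ g ω + h ω) :
    ∫⁻ ω, ENNReal.ofReal (f ω ^ 2) ∂μ ≤ 2 * ∫⁻ ω, ENNReal.ofReal (g ω ^ 2) ∂μ +
      2 * ∫⁻ ω, ENNReal.ofReal (h ω ^ 2) ∂μ := by
  rw [← lintegral_const_mul' _ _ (by norm_num), ← lintegral_const_mul' _ _ (by norm_num),
    ← lintegral_add_left ((hg.pow_const 2).ennreal_ofReal.const_mul 2)]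
  refine lintegral_mono fun ω => ?_
  rw [show (2 : ℝ≥0∞) = ENNReal.ofReal 2 by norm_num, ← ENNReal.ofReal_mul (by norm_num),
    ← ENNReal.ofReal_mul (by norm_num), ← ENNReal.ofReal_add (by positivity) (by positivity)]
  refine ENNReal.ofReal_le_ofReal ?_
  have := pow_le_pow_left₀ (hf ω) (hle ω) 2
  nlinarith [sq_nonneg (g ω - h ω)]

theorem sum_range_pow_four_le (d : ℕ) (a : ℕ → ℝ) :
    (∑ i ∈ Finset.range d, a i) ^ 4 ≤ (d : ℝ) ^ 3 * ∑ i ∈ Finset.range d, a i ^ 4 := by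
  have h1 := sq_sum_le_card_mul_sum_sq (s := Finset.range d) (f := a)
  have h2 := sq_sum_le_card_mul_sum_sq (s := Finset.range d) (f := fun i => a i ^ 2)
  rw [Finset.card_range] at h1 h2
  simp_rw [← pow_mul] at h2
  calc (∑ i ∈ Finset.range d, a i) ^ 4 = ((∑ i ∈ Finset.range d, a i) ^ 2) ^ 2 := by ring
    _ ≤ (d * ∑ i ∈ Finset.range d, a i ^ 2) ^ 2 := pow_le_pow_left₀ (sq_nonneg _) h1 2
    _ = d ^ 2 * (∑ i ∈ Finset.range d, a i ^ 2) ^ 2 := by ring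
    _ ≤ d ^ 2 * (d * ∑ i ∈ Finset.range d, a i ^ (2 * 2)) :=
        mul_le_mul_of_nonneg_left h2 (by positivity)
    _ = _ := by ring

theorem integral_pow_two_le_one_add [IsProbabilityMeasure μ] {s : Ω → ℝ}
    (h2 : Integrable (fun ω => s ω ^ 2) μ) (h4 : Integrable (fun ω => s ω ^ 4) μ) :
    ∫ ω, s ω ^ 2 ∂μ ≤ 1 + ∫ ω, s ω ^ 4 ∂μ := by
  have : ∫ ω, s ω ^ 2 ∂μ ≤ ∫ ω, (1 + s ω ^ 4) ∂μ :=
    integral_mono h2 ((integrable_const 1).add h4) fun ω => by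
      simp only
      nlinarith [sq_nonneg (s ω ^ 2 - 1)]
  rwa [integral_add (integrable_const 1) h4, integral_const, probReal_univ, one_smul] at this

end Moments

/-! ### Second moments of the closed loop under noise -/

namespace ControlSplitting

variable {d m : ℕ} {A : Matrix (Fin d) (Fin d) ℝ} {B : Matrix (Fin d) (Fin m) ℝ}
  (S : ControlSplitting A B) {r : ℝ} (hd : 0 < d) (hr : 0 < r)
  {Ω : Type*} {w : ℕ → Ω → RVec d} (x : RVec d)

/-- The state at time `t` is determined by the noise before `t`. -/
theorem measurable_traj_of_past (t : ℕ) :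
    Measurable[⨆ i ∈ {i | i < t}, MeasurableSpace.comap (w i) inferInstance]
      (fun ω => S.traj hd hr (fun s => w s ω) x t) := by
  -- The input reads the segment start, not just the preceding state, so strong induction is needed.
  induction t using Nat.strong_induction_on with
  | _ t ih =>
    rcases t with _ | t
    · simp only [traj_zero]
      exact measurable_const
    · simp only [traj_succ]
      have hmono : ∀ s ≤ t + 1, (⨆ i ∈ {i | i < s}, MeasurableSpace.comap (w i) inferInstance) ≤
          ⨆ i ∈ {i | i < t + 1}, MeasurableSpace.comap (w i) inferInstance := fun s hs =>
        biSup_mono fun i hi => lt_of_lt_of_le hi hs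
      have hle : d * (t / d) ≤ t := Nat.mul_div_le t d
      have h1 := (ih t (by omega)).mono (hmono t (by omega)) le_rfl
      have h2 := (ih (d * (t / d)) (by omega)).mono (hmono _ (by omega)) le_rfl
      have h3 : Measurable[⨆ i ∈ {i | i < t + 1}, MeasurableSpace.comap (w i) inferInstance]
          (w t) := (comap_measurable (w t)).mono
            (le_biSup (fun i => MeasurableSpace.comap (w i) inferInstance)
              (show t ∈ {i | i < t + 1} from Nat.lt_succ_self t)) le_rfl
      have hA : Measurable (Matrix.toEuclideanLin A) :=
        (LinearMap.continuous_of_finiteDimensional (Matrix.toEuclideanLin A)).measurable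
      have hB : Measurable (Matrix.toEuclideanLin B) :=
        (LinearMap.continuous_of_finiteDimensional (Matrix.toEuclideanLin B)).measurable
      exact ((hA.comp h1).add (hB.comp ((S.continuous_feedback hr _).measurable.comp h2))).add h3

/-- The circle part of the noise entering in a segment, minus the authority of the control. -/
noncomputable def excess (S : ControlSplitting A B) (r : ℝ) (w : ℕ → Ω → RVec d) (n : ℕ) (ω : Ω) :
    ℝ :=
  ∑ i ∈ Finset.range d, S.circle (w (d * n + i) ω) - r

variable [MeasurableSpace Ω] {μ : Measure Ω}

theorem measurable_traj (hw : ∀ t, Measurable (w t)) (t : ℕ) :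
    Measurable fun ω => S.traj hd hr (fun s => w s ω) x t :=
  (S.measurable_traj_of_past hd hr x t).mono (iSup₂_le fun i _ => (hw i).comap_le) le_rfl

theorem measurable_excess (hw : ∀ t, Measurable (w t)) (n : ℕ) : Measurable (S.excess r w n) :=
  (Finset.measurable_sum _ fun _ _ => S.continuous_circle.measurable.comp (hw _)).sub_const r

/-- The state at time `d * n` uses noises with index below `d * n`; the excess uses only later ones.
-/
theorem indepFun_excess_traj (hw : ∀ t, Measurable (w t)) (hind : iIndepFun w μ) (n : ℕ) :
    IndepFun (S.excess r w n) (fun ω => S.traj hd hr (fun s => w s ω) x (d * n)) μ := by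
  have hdis : Disjoint {i | d * n ≤ i} {i | i < d * n} :=
    Set.disjoint_left.2 fun i (hi : d * n ≤ i) (hi' : i < d * n) => absurd hi' (not_lt.2 hi)
  have h := indep_iSup_of_disjoint (fun i => (hw i).comap_le) hind hdis
  rw [IndepFun_iff_Indep]
  refine indep_of_indep_of_le_left (indep_of_indep_of_le_right h ?_) ?_
  · exact (S.measurable_traj_of_past hd hr x (d * n)).comap_le
  · refine Measurable.comap_le ?_
    refine Measurable.sub_const (Finset.measurable_sum _ fun i _ => ?_) r
    refine S.continuous_circle.measurable.comp ?_
    exact (comap_measurable (w (d * n + i))).mono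
      (le_biSup (fun i => MeasurableSpace.comap (w i) inferInstance)
        (show d * n + i ∈ {i | d * n ≤ i} from Nat.le_add_right _ _)) le_rfl

theorem memLp_circle {f : Ω → RVec d} (hf : MemLp f 4 μ) :
    MemLp (fun ω => S.circle (f ω)) 4 μ :=
  hf.of_le_mul (c := S.bound)
    (S.continuous_circle.comp_aestronglyMeasurable hf.aestronglyMeasurable)
    (Eventually.of_forall fun ω => by
      rw [Real.norm_of_nonneg (apply_nonneg _ _)]
      exact S.circle_le _)

theorem memLp_excess [IsProbabilityMeasure μ] (h4 : ∀ t, MemLp (w t) 4 μ) (n : ℕ) :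
    MemLp (S.excess r w n) 4 μ :=
  (memLp_finsetSum (Finset.range d) fun i _ => S.memLp_circle (h4 (d * n + i))).sub
    (memLp_const r)

/-- This fixes how large `r` must be: `‖w‖ ≤ 1 + ‖w‖ ^ 4` bounds the mean noise of a segment, and
one further unit provides the drift. -/
theorem integral_excess_le [IsProbabilityMeasure μ] {W : ℝ}
    (hW : ∀ t, MemLp (w t) 4 μ ∧ ∫ ω, ‖w t ω‖ ^ 4 ∂μ ≤ W)
    (hrW : d * (S.bound * (1 + W)) + 1 ≤ r) (n : ℕ) : ∫ ω, S.excess r w n ω ∂μ ≤ -1 := by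
  have hi : ∀ t, Integrable (fun ω => S.circle (w t ω)) μ := fun t =>
    (S.memLp_circle (hW t).1).integrable (by norm_num)
  have hi4 : ∀ t, Integrable (fun ω => ‖w t ω‖ ^ 4) μ := fun t =>
    (hW t).1.integrable_norm_pow (p := 4) (by norm_num)
  have hle : ∀ t, ∫ ω, S.circle (w t ω) ∂μ ≤ S.bound * (1 + W) := by
    intro t
    calc _ ≤ ∫ ω, S.bound * (1 + ‖w t ω‖ ^ 4) ∂μ := by
          refine integral_mono (hi t) (((integrable_const 1).add (hi4 t)).const_mul _) fun ω => ?_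
          refine (S.circle_le _).trans (mul_le_mul_of_nonneg_left ?_ S.bound_nonneg)
          nlinarith [sq_nonneg (‖w t ω‖ ^ 2 - 1), sq_nonneg (‖w t ω‖ - 1)]
      _ = S.bound * (1 + ∫ ω, ‖w t ω‖ ^ 4 ∂μ) := by
          rw [integral_const_mul, integral_add (integrable_const 1) (hi4 t), integral_const,
            probReal_univ, one_smul]
      _ ≤ _ := mul_le_mul_of_nonneg_left (by linarith [(hW t).2]) S.bound_nonneg
  have heq : ∫ ω, S.excess r w n ω ∂μ =
      ∑ i ∈ Finset.range d, ∫ ω, S.circle (w (d * n + i) ω) ∂μ - r := by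
    simp only [excess]
    rw [integral_sub (integrable_finsetSum _ fun i _ => hi _) (integrable_const r),
      integral_finsetSum _ fun i _ => hi _, integral_const, probReal_univ, one_smul]
  have hsum := Finset.sum_le_sum fun i (_ : i ∈ Finset.range d) => hle (d * n + i)
  rw [Finset.sum_const, Finset.card_range, nsmul_eq_mul] at hsum
  linarith

theorem integral_excess_pow_four_le [IsProbabilityMeasure μ] {W : ℝ}
    (hW : ∀ t, MemLp (w t) 4 μ ∧ ∫ ω, ‖w t ω‖ ^ 4 ∂μ ≤ W) (n : ℕ) :
    Integrable (fun ω => S.excess r w n ω ^ 4) μ ∧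
    ∫ ω, S.excess r w n ω ^ 4 ∂μ ≤ 8 * (d ^ 3 * (S.bound ^ 4 * (d * W))) + 8 * r ^ 4 := by
  have hi4 : ∀ t, Integrable (fun ω => ‖w t ω‖ ^ 4) μ := fun t =>
    (hW t).1.integrable_norm_pow (p := 4) (by norm_num)
  have hint : Integrable (fun ω => S.excess r w n ω ^ 4) μ := by
    refine ((S.memLp_excess (r := r) (fun t => (hW t).1) n).integrable_norm_pow (p := 4)
      (by norm_num)).congr (Eventually.of_forall fun ω => ?_)
    simp only [Real.norm_eq_abs]
    exact Even.pow_abs (by decide) _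
  refine ⟨hint, ?_⟩
  have hpt : ∀ ω, S.excess r w n ω ^ 4 ≤
      8 * (d ^ 3 * (S.bound ^ 4 * ∑ i ∈ Finset.range d, ‖w (d * n + i) ω‖ ^ 4)) + 8 * r ^ 4 := by
    intro ω
    set ξ := ∑ i ∈ Finset.range d, S.circle (w (d * n + i) ω) with hξ
    have h1 : (ξ - r) ^ 4 ≤ 8 * ξ ^ 4 + 8 * r ^ 4 := by
      have e1 : (ξ - r) ^ 2 ≤ 2 * (ξ ^ 2 + r ^ 2) := by nlinarith [sq_nonneg (ξ + r)]
      have e2 := pow_le_pow_left₀ (sq_nonneg _) e1 2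
      nlinarith [sq_nonneg (ξ ^ 2 - r ^ 2)]
    have h2 := sum_range_pow_four_le d fun i => S.circle (w (d * n + i) ω)
    have h3 : ∑ i ∈ Finset.range d, S.circle (w (d * n + i) ω) ^ 4 ≤
        S.bound ^ 4 * ∑ i ∈ Finset.range d, ‖w (d * n + i) ω‖ ^ 4 := by
      rw [Finset.mul_sum]
      refine Finset.sum_le_sum fun i _ => ?_
      rw [← mul_pow]
      exact pow_le_pow_left₀ (apply_nonneg _ _) (S.circle_le _) 4
    have h4 := mul_le_mul_of_nonneg_left h3 (show (0 : ℝ) ≤ (d : ℝ) ^ 3 by positivity)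
    change (ξ - r) ^ 4 ≤ _
    linarith
  have hsi : Integrable (fun ω => ∑ i ∈ Finset.range d, ‖w (d * n + i) ω‖ ^ 4) μ :=
    integrable_finsetSum _ fun i _ => hi4 _
  have hsum : ∑ i ∈ Finset.range d, ∫ ω, ‖w (d * n + i) ω‖ ^ 4 ∂μ ≤ d * W := by
    have := Finset.sum_le_sum fun i (_ : i ∈ Finset.range d) => (hW (d * n + i)).2
    rwa [Finset.sum_const, Finset.card_range, nsmul_eq_mul] at this
  have hb := S.bound_nonneg
  calc _ ≤ ∫ ω, (8 * (d ^ 3 * (S.bound ^ 4 * ∑ i ∈ Finset.range d, ‖w (d * n + i) ω‖ ^ 4))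
        + 8 * r ^ 4) ∂μ := integral_mono hint
          ((((hsi.const_mul _).const_mul _).const_mul _).add (integrable_const _)) hpt
    _ = 8 * (d ^ 3 * (S.bound ^ 4 * ∑ i ∈ Finset.range d, ∫ ω, ‖w (d * n + i) ω‖ ^ 4 ∂μ))
        + 8 * r ^ 4 := by
        rw [integral_add (((hsi.const_mul _).const_mul _).const_mul _) (integrable_const _),
          integral_const_mul, integral_const_mul, integral_const_mul,
          integral_finsetSum _ fun i _ => hi4 _, integral_const, probReal_univ, one_smul]
    _ ≤ _ := by gcongr

/-- Uniform second moments of the circle part at the starts of the segments. -/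
theorem exists_lintegral_circle_start_le [IsProbabilityMeasure μ] {W : ℝ}
    (hw : ∀ t, Measurable (w t)) (hind : iIndepFun w μ)
    (hW : ∀ t, MemLp (w t) 4 μ ∧ ∫ ω, ‖w t ω‖ ^ 4 ∂μ ≤ W)
    (hrW : d * (S.bound * (1 + W)) + 1 ≤ r) :
    ∃ M : ℝ≥0∞, M < ∞ ∧ ∀ n,
      ∫⁻ ω, ENNReal.ofReal (S.circle (S.traj hd hr (fun s => w s ω) x (d * n)) ^ 2) ∂μ ≤ M := by
  set b₄ := 8 * (d ^ 3 * (S.bound ^ 4 * (d * W))) + 8 * r ^ 4 with hb₄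
  -- `K` dominates the initial value and the saturation level, and meets the moment thresholds of
  -- the drift lemma with `b₂ = 1 + b₄`.
  set K := max (max 1 (max r (S.circle x))) (max (32 * (1 + b₄)) (8 * b₄)) with hK
  have hK1 : 1 ≤ K := le_max_of_le_left (le_max_left _ _)
  have hKr : r ≤ K := le_max_of_le_left (le_max_of_le_right (le_max_left _ _))
  have hKx : S.circle x ≤ K := le_max_of_le_left (le_max_of_le_right (le_max_right _ _))
  -- Truncating below at `r` linearizes the threshold: `max (c - r) 0 = max c r - r`, so the
  -- increment is exactly the excess.
  set X : ℕ → Ω → ℝ := fun n ω =>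
    max (S.circle (S.traj hd hr (fun s => w s ω) x (d * n))) r with hX
  have hmax : Measurable fun y : RVec d => max (S.circle y) r :=
    (S.continuous_circle.max continuous_const).measurable
  have hXm : ∀ n, Measurable (X n) := fun n => hmax.comp (S.measurable_traj hd hr x hw (d * n))
  have htail := measure_le_cubicTail_of_drift (μ := μ) (X := X) (s := S.excess r w) (K := K)
    (b₂ := 1 + b₄) (b₄ := b₄) hXm (S.measurable_excess hw)
    (fun n => (S.indepFun_excess_traj hd hr x hw hind n).comp measurable_id hmax)
    (S.memLp_excess fun t => (hW t).1) (S.integral_excess_le hW hrW)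
    (fun n => by
      have h4 := S.integral_excess_pow_four_le (r := r) hW n
      have h2 := ((S.memLp_excess (r := r) (fun t => (hW t).1) n).mono_exponent
        (show (2 : ℝ≥0∞) ≤ 4 by norm_num)).integrable_sq
      linarith [integral_pow_two_le_one_add h2 h4.1])
    (fun n => (S.integral_excess_pow_four_le hW n).2) hK1
    (le_max_of_le_right (le_max_left _ _)) (le_max_of_le_right (le_max_right _ _))
    (fun ω => by
      simp only [hX, mul_zero, traj_zero]
      exact max_le hKx hKr)
    (fun n ω => by
      have h := S.circle_traj_segment_le hd hr (fun s => w s ω) x n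
      refine max_le (le_max_of_le_left (h.trans (le_of_eq ?_))) (le_max_of_le_right hKr)
      simp only [hX, excess]
      rw [show (0 : ℝ) = r - r by ring, max_sub_sub_right]
      ring)
  refine ⟨ENNReal.ofReal (9 * K ^ 2), ENNReal.ofReal_lt_top, fun n => ?_⟩
  refine le_trans (lintegral_mono fun ω => ENNReal.ofReal_le_ofReal ?_)
    (lintegral_sq_le_of_cubicTail (hXm n) (fun ω => le_max_of_le_right hr.le) (by linarith)
      (htail n))
  exact pow_le_pow_left₀ (apply_nonneg _ _) (le_max_left _ _) 2

theorem exists_lintegral_input_add_noise_le [IsProbabilityMeasure μ] {W : ℝ} (c : ℝ)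
    (hW : ∀ t, MemLp (w t) 4 μ ∧ ∫ ω, ‖w t ω‖ ^ 4 ∂μ ≤ W) :
    ∃ M : ℝ≥0∞, M < ∞ ∧ ∀ t,
      ∫⁻ ω, ENNReal.ofReal ((c + S.bound * ‖w t ω‖) ^ 2) ∂μ ≤ M := by
  refine ⟨ENNReal.ofReal (2 * c ^ 2 + 2 * S.bound ^ 2 * (1 + W)), ENNReal.ofReal_lt_top,
    fun t => ?_⟩
  have hi4 : Integrable (fun ω => ‖w t ω‖ ^ 4) μ :=
    (hW t).1.integrable_norm_pow (p := 4) (by norm_num)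
  have hi1 : Integrable (fun ω => 2 * S.bound ^ 2 * (1 + ‖w t ω‖ ^ 4)) μ :=
    ((integrable_const _).add hi4).const_mul _
  have hi : Integrable (fun ω => 2 * c ^ 2 + 2 * S.bound ^ 2 * (1 + ‖w t ω‖ ^ 4)) μ :=
    (integrable_const _).add hi1
  calc _ ≤ ∫⁻ ω, ENNReal.ofReal (2 * c ^ 2 + 2 * S.bound ^ 2 * (1 + ‖w t ω‖ ^ 4)) ∂μ := by
        refine lintegral_mono fun ω => ENNReal.ofReal_le_ofReal ?_
        have h1 : ‖w t ω‖ ^ 2 ≤ 1 + ‖w t ω‖ ^ 4 := by nlinarith [sq_nonneg (‖w t ω‖ ^ 2 - 1)]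
        have h2 := mul_le_mul_of_nonneg_left h1 (show 0 ≤ 2 * S.bound ^ 2 by positivity)
        nlinarith [sq_nonneg (c - S.bound * ‖w t ω‖)]
    _ = ENNReal.ofReal (∫ ω, (2 * c ^ 2 + 2 * S.bound ^ 2 * (1 + ‖w t ω‖ ^ 4)) ∂μ) :=
        (ofReal_integral_eq_lintegral_ofReal hi (Eventually.of_forall fun ω => by positivity)).symm
    _ ≤ _ := by
        refine ENNReal.ofReal_le_ofReal ?_
        rw [integral_add (integrable_const _) hi1,
          integral_const, integral_const_mul, integral_add (integrable_const _) hi4, integral_const,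
          probReal_univ, one_smul, one_smul]
        have := (hW t).2
        gcongr

/-- Uniform second moments of the circle part at all times. -/
theorem exists_lintegral_circle_le [IsProbabilityMeasure μ] {W : ℝ}
    (hw : ∀ t, Measurable (w t)) (hind : iIndepFun w μ)
    (hW : ∀ t, MemLp (w t) 4 μ ∧ ∫ ω, ‖w t ω‖ ^ 4 ∂μ ≤ W)
    (hrW : d * (S.bound * (1 + W)) + 1 ≤ r) :
    ∃ M : ℝ≥0∞, M < ∞ ∧ ∀ t,
      ∫⁻ ω, ENNReal.ofReal (S.circle (S.traj hd hr (fun s => w s ω) x t) ^ 2) ∂μ ≤ M := by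
  obtain ⟨H, hH, hη⟩ := S.exists_lintegral_input_add_noise_le
    (S.inputBound * (S.bound * r)) hW
  -- The bound may grow with the offset `j` inside a segment, since only `d` offsets occur.
  have hj : ∀ j : ℕ, ∃ M : ℝ≥0∞, M < ∞ ∧ ∀ n,
      ∫⁻ ω, ENNReal.ofReal (S.circle (S.traj hd hr (fun s => w s ω) x (d * n + j)) ^ 2) ∂μ ≤ M := by
    intro j
    induction j with
    | zero => exact S.exists_lintegral_circle_start_le hd hr x hw hind hW hrW
    | succ j ih =>
      obtain ⟨M, hM, h⟩ := ih
      refine ⟨2 * M + 2 * H, by finiteness, fun n => ?_⟩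
      refine (lintegral_sq_le_of_le_add
        (g := fun ω => S.circle (S.traj hd hr (fun s => w s ω) x (d * n + j)))
        (h := fun ω => S.inputBound * (S.bound * r) + S.bound * ‖w (d * n + j) ω‖)
        (S.continuous_circle.measurable.comp (S.measurable_traj hd hr x hw _))
        (fun ω => apply_nonneg _ _) fun ω => ?_).trans ?_
      · refine (S.circle_traj_succ_le hd hr (fun s => w s ω) x (d * n + j)).trans ?_
        rw [add_assoc]
        gcongr
        · exact S.inputBound_nonneg
        · exact S.norm_feedback_le hr _ _
        · exact S.circle_le _
      · gcongr
        · exact h n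
        · exact hη _
  choose M hM h using hj
  refine ⟨∑ j ∈ Finset.range d, M j, ENNReal.sum_lt_top.2 fun j _ => hM j, fun t => ?_⟩
  have h1 := h (t % d) (t / d)
  rw [Nat.div_add_mod] at h1
  exact h1.trans (Finset.single_le_sum (f := M) (fun _ _ => zero_le)
    (Finset.mem_range.2 (Nat.mod_lt t hd)))

/-- Uniform second moments of the stable part. -/
theorem exists_lintegral_stable_le [IsProbabilityMeasure μ] {W : ℝ}
    (hw : ∀ t, Measurable (w t)) (hW : ∀ t, MemLp (w t) 4 μ ∧ ∫ ω, ‖w t ω‖ ^ 4 ∂μ ≤ W) :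
    ∃ M : ℝ≥0∞, M < ∞ ∧ ∀ t,
      ∫⁻ ω, ENNReal.ofReal (S.stable (S.traj hd hr (fun s => w s ω) x t) ^ 2) ∂μ ≤ M := by
  obtain ⟨H, hH, hη⟩ := S.exists_lintegral_input_add_noise_le
    (S.inputBound * (S.bound * r)) hW
  have hρ : 0 < 1 - S.rate := by linarith [S.rate_lt_one]
  have hρ0 := S.rate_nonneg
  set h := H.toReal with hh
  have hh0 : 0 ≤ h := ENNReal.toReal_nonneg
  have hHh : H = ENNReal.ofReal h := (ENNReal.ofReal_toReal hH.ne).symm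
  -- `M` is chosen so that `rate * M + h / (1 - rate) ≤ M`, which closes the induction.
  set M := S.stable x ^ 2 + h / (1 - S.rate) ^ 2 with hM
  have hM0 : 0 ≤ M := by positivity
  refine ⟨ENNReal.ofReal M, ENNReal.ofReal_lt_top, fun t => ?_⟩
  induction t with
  | zero =>
    simp only [traj_zero, lintegral_const, measure_univ, mul_one]
    refine ENNReal.ofReal_le_ofReal (le_add_of_nonneg_right (by positivity))
  | succ t ih =>
    calc _ ≤ ∫⁻ ω, (ENNReal.ofReal S.rate *
            ENNReal.ofReal (S.stable (S.traj hd hr (fun s => w s ω) x t) ^ 2) +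
            ENNReal.ofReal (1 - S.rate)⁻¹ * ENNReal.ofReal
              ((S.inputBound * (S.bound * r) + S.bound * ‖w t ω‖) ^ 2)) ∂μ := by
          refine lintegral_mono fun ω => ?_
          rw [← ENNReal.ofReal_mul hρ0, ← ENNReal.ofReal_mul (by positivity),
            ← ENNReal.ofReal_add (by positivity) (by positivity)]
          refine ENNReal.ofReal_le_ofReal ?_
          set a := S.stable (S.traj hd hr (fun s => w s ω) x t) with ha
          set b := S.inputBound * (S.bound * r) + S.bound * ‖w t ω‖ with hb
          have h1 : S.stable (S.traj hd hr (fun s => w s ω) x (t + 1)) ≤ S.rate * a + b := by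
            refine (S.stable_traj_succ_le hd hr (fun s => w s ω) x t).trans ?_
            rw [add_assoc, hb]
            gcongr
            · exact S.inputBound_nonneg
            · exact S.norm_feedback_le hr _ _
            · exact S.stable_le _
          refine (pow_le_pow_left₀ (apply_nonneg _ _) h1 2).trans ?_
          -- Convexity of the square with weights `rate` and `1 - rate`, at the points `a` and `b /
          -- (1 - rate)`.
          have e : S.rate * a ^ 2 + (1 - S.rate)⁻¹ * b ^ 2 - (S.rate * a + b) ^ 2 =
              S.rate * (1 - S.rate) * (a - (1 - S.rate)⁻¹ * b) ^ 2 := by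
            field_simp
            ring
          have e' : 0 ≤ S.rate * (1 - S.rate) * (a - (1 - S.rate)⁻¹ * b) ^ 2 := by positivity
          linarith
      _ = ENNReal.ofReal S.rate *
            ∫⁻ ω, ENNReal.ofReal (S.stable (S.traj hd hr (fun s => w s ω) x t) ^ 2) ∂μ +
            ENNReal.ofReal (1 - S.rate)⁻¹ * ∫⁻ ω, ENNReal.ofReal
              ((S.inputBound * (S.bound * r) + S.bound * ‖w t ω‖) ^ 2) ∂μ := by
          rw [lintegral_add_left, lintegral_const_mul' _ _ ENNReal.ofReal_ne_top,
            lintegral_const_mul' _ _ ENNReal.ofReal_ne_top]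
          exact ((S.continuous_stable.measurable.comp
            (S.measurable_traj hd hr x hw t)).pow_const 2).ennreal_ofReal.const_mul _
      _ ≤ ENNReal.ofReal S.rate * ENNReal.ofReal M +
            ENNReal.ofReal (1 - S.rate)⁻¹ * ENNReal.ofReal h := by
          gcongr
          exact (hη t).trans hHh.le
      _ ≤ ENNReal.ofReal M := by
          rw [← ENNReal.ofReal_mul hρ0, ← ENNReal.ofReal_mul (by positivity),
            ← ENNReal.ofReal_add (by positivity) (by positivity)]
          refine ENNReal.ofReal_le_ofReal ?_
          have e : (1 - S.rate)⁻¹ * h = (1 - S.rate) * (h / (1 - S.rate) ^ 2) := by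
            field_simp
          have e' : 0 ≤ (1 - S.rate) * S.stable x ^ 2 := by positivity
          rw [e]
          nlinarith

theorem iSup_lintegral_traj_lt_top [IsProbabilityMeasure μ] {W : ℝ}
    (hw : ∀ t, Measurable (w t)) (hind : iIndepFun w μ)
    (hW : ∀ t, MemLp (w t) 4 μ ∧ ∫ ω, ‖w t ω‖ ^ 4 ∂μ ≤ W)
    (hrW : d * (S.bound * (1 + W)) + 1 ≤ r) :
    (⨆ t, ∫⁻ ω, ‖S.traj hd hr (fun s => w s ω) x t‖ₑ ^ 2 ∂μ) < ∞ := by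
  obtain ⟨M, hM, h⟩ := S.exists_lintegral_circle_le hd hr x hw hind hW hrW
  obtain ⟨M', hM', h'⟩ := S.exists_lintegral_stable_le hd hr x hw hW
  refine lt_of_le_of_lt (iSup_le fun t => ?_) (show 2 * M + 2 * M' < ∞ by finiteness)
  calc _ = ∫⁻ ω, ENNReal.ofReal (‖S.traj hd hr (fun s => w s ω) x t‖ ^ 2) ∂μ := by
        refine lintegral_congr fun ω => ?_
        rw [ENNReal.ofReal_pow (norm_nonneg _), ofReal_norm]
    _ ≤ _ := lintegral_sq_le_of_le_add
        (S.continuous_circle.measurable.comp (S.measurable_traj hd hr x hw t))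
        (fun ω => norm_nonneg _) fun ω => S.norm_le _
    _ ≤ _ := by
        gcongr
        · exact h t
        · exact h' t

end ControlSplitting

/-! ### Conclusion -/

theorem theorem1 {d m : ℕ} (hd : 0 < d)
    (A : Matrix (Fin d) (Fin d) ℝ) (B : Matrix (Fin d) (Fin m) ℝ)
    (hA : MarginallyStable A) (hAB : Stabilizable A B)
    {Ω : Type*} [MeasurableSpace Ω] (μ : Measure Ω) [IsProbabilityMeasure μ]
    (w : ℕ → Ω → RVec d) (hw_meas : ∀ t, Measurable (w t))
    (hw_indep : iIndepFun w μ) (hw_mean : ∀ t, ∫ ω, w t ω ∂μ = 0)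
    (hw_fourth : (⨆ t, ∫⁻ ω, ‖w t ω‖ₑ ^ 4 ∂μ) < ∞) :
    ∃ R : ℝ, 0 < R ∧ ∃ k : ℕ, 1 ≤ k ∧ k ≤ d ∧ ∃ p : HistoryPolicy d m k,
      p.IsConcatenation ∧
      (∀ t h, ‖p.act t h‖ ≤ R) ∧
      (∀ x : RVec d,
        (⨆ t, ∫⁻ ω, ‖closedLoop A B p (fun s => w s ω) x t‖ₑ ^ 2 ∂μ) < ∞) ∧
      OriginAsymptoticallyStable (fun x => closedLoop A B p 0 x) ∧
      (∀ x : RVec d, ∃ T : ℕ, ∀ t, T ≤ t →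
        UnitCirclePartVanishes A (closedLoop A B p 0 x t)) := by
  obtain ⟨S⟩ := exists_controlSplitting hA hAB
  obtain ⟨W, hW0, hW⟩ := exists_fourth_moment_bound hw_meas hw_fourth
  have hb := S.bound_nonneg
  obtain ⟨r, hrW⟩ : ∃ r : ℝ, d * (S.bound * (1 + W)) + 1 = r := ⟨_, rfl⟩
  have hr : 0 < r := by rw [← hrW]; positivity
  -- The added `1` keeps the bound positive when `S.bound = 0`. The history length is `k = d`.
  refine ⟨S.bound * r + 1, by positivity, d, hd, le_rfl, S.policy hd hr,
    S.isConcatenation_policy hd hr, fun t h => ?_, fun x => ?_,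
    S.originAsymptoticallyStable_traj hd hr, fun x => S.exists_unitCirclePartVanishes_traj hd hr x⟩
  · exact (S.norm_feedback_le hr _ _).trans (by linarith)
  · exact S.iSup_lintegral_traj_lt_top hd hr x hw_meas hw_indep hW hrW.le
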